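/- **Setting.** Let $(K,v)$ be a $p$-adically closed field, that is, a Henselian valued field of characteristic $0$ with finite residue field whose value group $\mathcal Z=v(K^\times)$ is a $\mathbb Z$-group (a linearly ordered abelian group with a smallest positive element $1$ and with $|\mathcal Z/n\mathcal Z|=n$ for all $n\ge1$; no other property of $K$ is assumed). Let $R$ be its valuation ring, $\pi$ a generator of the maximal ideal of $R$, $\mathcal Q$ the divisible hull of $\mathcal Z$, $\Gamma=\mathcal Z\cup\{+\infty\}=v(K)$ and $\Omega=\mathcal Q\cup\{+\infty\}$. $\Omega$ carries the topology generated by the open intervals and the intervals $]a,+\infty]$ with $a\in\mathcal Q$, $\Gamma^m\subseteq\Omega^m$ the induced topology, and $K^m$ the product of the valuation topology. Write $\overline A$ for the closure of $A$; the *frontier* $\partial A$ is the closure of $\overline A\setminus A$, and $A$ is *relatively open* if $\overline A\setminus A$ is closed. A subset of $K^m$ is *semi-algebraic* if it is definable with parameters in the language of rings. Write $v$ also for the map $(v,\dots,v):K^m\to\Gamma^m$. **Precells in $\Gamma^m$.** The *support* of $a\in\Gamma^m$ is $\operatorname{Supp}a=\{i: a_i\neq+\infty\}$. For $A\subseteq\Gamma^m$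 and $J\subseteq\{1,\dots,m\}$ let $F_J(A)=\{a\in\overline A:\operatorname{Supp}a=J\}$; when non-empty it is a *face* of $A$. $A$ is *monohedral* if, for any two faces of $A$, one is contained in the closure of the other. A function $f:A\to\Omega$, where all elements of $A$ have the same support $I$, is *affine* if $f\equiv+\infty$ or $f(a)=\alpha_0+\sum_{i\in I}\alpha_ia_i$ with $\alpha_0\in\mathcal Q$, $\alpha_i\in\mathbb Q$; it is *largely continuous* if it extends to a continuous $\Omega$-valued function on $\overline A$. In $\Gamma$, $a\equiv b\,[n]$ means $a-b\in n\mathcal Z$ if $a,b\in\mathcal Z$, and holds by convention if $a=+\infty$ or $b=+\infty$. Let $N\in(\mathbb N^*)^m$. The only *largely continuous precell mod $N$* in $\Gamma^0$ is $\Gamma^0$. For $m\ge1$, $A\subseteq\Gamma^m$ is a largely continuous precell mod $N$ if its image $\widehat A$ under the projection onto the first $m-1$ coordinates is a largely continuous precell mod $(N_1,\dots,N_{m-1})$ and there are $I\subseteq\{1,\dots,m\}$, non-negative largely continuous affine maps $\mu,\nu:\widehat A\to\Omega$ and an integer $0\le\rho<N_m$ such that $A$ is exactly the set of $a\in\Gamma^m$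 of support $I$ with $\widehat a:=(a_1,\dots,a_{m-1})\in\widehat A$, $\mu(\widehat a)\le a_m\le\nu(\widehat a)$ and $a_m\equiv\rho\,[N_m]$. **Monotopes.** For $M\ge1$ let $\mathrm{ac}_M:K^\times\to(R/\pi^MR)^\times$ be the unique group homomorphism with $\mathrm{ac}_M(\pi)=1$ and $\mathrm{ac}_M(u)=u\bmod\pi^M$ for every unit $u$ of $R$, let $Q_{1,M}=\ker(\mathrm{ac}_M)$ (so $Q_{1,M}=\bigcup_{k\in\mathbb Z}\pi^k(1+\pi^MR)$ when $\mathcal Z=\mathbb Z$), and $D^MR=(\{0\}\cup Q_{1,M})\cap R$; write $D^MR^m$ for $(D^MR)^m$. A set $S\subseteq K^m$ is a *monotope mod $N$ in $D^MR^m$* if $v(S)$ is a monohedral largely continuous precell mod $N$ in $\Gamma^m$ and $S=v^{-1}(v(S))\cap D^MR^m$. The *faces* of $S$ are the sets $v^{-1}(F)\cap D^MR^m$ with $F$ a face of $v(S)$. A *complex* of monotopes mod $N$ in $D^MR^m$ is a finite family $\mathcal A$ of such monotopes such that, for all $S,T\in\mathcal A$, $\overline S\cap\overline T$ is the union of the common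 faces of $S$ and $T$. **Proposition 6.4.** Let $m\ge0$, $M\ge1$, $N\in(\mathbb N^*)^m$, and let $A\subseteq D^MR^m$ be a relatively open set which is the union of a complex of monotopes mod $N$ in $D^MR^m$. Then for every integer $n\ge1$ there is a partition of $A$ into semi-algebraic sets $A_1,\dots,A_n$ (pairwise disjoint with union $A$, possibly empty) such that $\partial A_k=\partial A$ for every $k$. -/

import Mathlib

open Set

noncomputable section

namespace PadicPolytope

universe u w

/-! ## `ℤ`-groups and the spaces `Γ = 𝒵 ∪ {+∞}`, `Ω = 𝒬 ∪ {+∞}` -/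

section ZGroup

variable (G : Type w) [AddCommGroup G] [LinearOrder G] [IsOrderedAddMonoid G]

/-- A `ℤ`-group: a linearly ordered abelian group with a smallest positive element and such that
`G / nG` has exactly `n` elements for every `n ≥ 1`. -/
structure IsZGroup : Prop where
  exists_least_pos : ∃ e : G, IsLeast {x : G | 0 < x} e
  card_quotient : ∀ n : ℕ, 1 ≤ n → Nat.card (G ⧸ (nsmulAddMonoidHom (α := G) n).range) = n

/-- `Γ = 𝒵 ∪ {+∞}`. -/
abbrev Gam : Type w := WithTop G

/-- `Ω = 𝒬 ∪ {+∞}`, where `𝒬` is the divisible hull of `𝒵`. -/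
abbrev Om : Type w := WithTop (DivisibleHull G)

variable {G}

/-- The inclusion of `Γ` in `Ω`. -/
def toOm : Gam G → Om G := WithTop.map (fun g => (DivisibleHull.coe g : DivisibleHull G))

/-- The congruence `a ≡ ρ [N]` in `Γ`, where the integer `ρ` is identified with `ρ` times the
smallest positive element of `𝒵`. By convention `+∞` is congruent to everything. -/
def GamModEq (a : Gam G) (ρ N : ℕ) : Prop :=
  ∀ z : G, a = (z : WithTop G) →
    ∃ e b : G, IsLeast {x : G | 0 < x} e ∧ z = ρ • e + N • b

variable (G)

/-- The topology of `Ω`, generated by the open intervals and the intervals `]a, +∞]`: this is the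
order topology. -/
abbrev omTop : TopologicalSpace (Om G) := Preorder.topology _

/-- The topology of `Γ`. When `𝒵` is a `ℤ`-group the order topology of `Γ` is the
topology induced by `Ω`: the points of `𝒵` are isolated, and the intervals `]a, +∞]` form a basis of
neighbourhoods of `+∞`. -/
abbrev gamTop : TopologicalSpace (Gam G) := Preorder.topology _

/-- The product topology of `Γ^m`. -/
abbrev gamPiTop (m : ℕ) : TopologicalSpace (Fin m → Gam G) :=
  @Pi.topologicalSpace (Fin m) (fun _ => Gam G) (fun _ => gamTop G)

variable {G}

/-- The topological closure in `Γ^m` (which is closed in `Ω^m`). -/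
def gamClosure {m : ℕ} (A : Set (Fin m → Gam G)) : Set (Fin m → Gam G) :=
  @closure _ (gamPiTop G m) A

/-- The support of a point of `Γ^m`: the set of indices of its finite coordinates. -/
def gamSupp {m : ℕ} (a : Fin m → Gam G) : Set (Fin m) := {i | a i ≠ ⊤}

/-- `F_J(A)`, the set of points of support `J` in the closure of `A`. When it is non-empty it is
called the face of `A` of support `J`. -/
def gamFace {m : ℕ} (J : Set (Fin m)) (A : Set (Fin m → Gam G)) : Set (Fin m → Gam G) :=
  {a | a ∈ gamClosure A ∧ gamSupp a = J}

/-- `A` is monohedral if its faces are linearly ordered by specialisation, where `B ≤ C` means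
that `B` is contained in the closure of `C`. -/
def IsMonohedral {m : ℕ} (A : Set (Fin m → Gam G)) : Prop :=
  ∀ J H : Set (Fin m), (gamFace J A).Nonempty → (gamFace H A).Nonempty →
    gamFace J A ⊆ gamClosure (gamFace H A) ∨ gamFace H A ⊆ gamClosure (gamFace J A)

/-- `f` restricts to an affine map on `A`, for a set `A` all of whose elements have the same
support `I`: either `f` is constantly `+∞` on `A`, or `f(a) = α₀ + ∑_{i ∈ I} αᵢ aᵢ` for some
`α₀ ∈ 𝒬` and some rational numbers `αᵢ`. (The coordinates with `i ∉ I` are infinite: they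
contribute `0` to the sum below.) -/
def IsAffineOn {m : ℕ} (f : (Fin m → Gam G) → Om G) (A : Set (Fin m → Gam G)) : Prop :=
  (∀ a ∈ A, f a = ⊤) ∨
  ∃ (α₀ : DivisibleHull G) (α : Fin m → ℚ), ∀ a ∈ A,
    f a = ((α₀ + ∑ i, α i • (DivisibleHull.coe ((a i).untopD 0) : DivisibleHull G) :
      DivisibleHull G) : WithTop (DivisibleHull G))

/-- `f` is largely continuous on `A`: its restriction to `A` extends to a continuous `Ω`-valued
function on the closure of `A`. -/
def IsLargelyContinuousOn {m : ℕ} (f : (Fin m → Gam G) → Om G) (A : Set (Fin m → Gam G)) :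
    Prop :=
  ∃ g : (Fin m → Gam G) → Om G,
    @ContinuousOn _ _ (gamPiTop G m) (omTop G) g (gamClosure A) ∧ EqOn g f A

/-- The socle of `A ⊆ Γ^(m+1)`: its image in `Γ^m` under the projection on the first `m`
coordinates. -/
def socle {m : ℕ} (A : Set (Fin (m + 1) → Gam G)) : Set (Fin m → Gam G) :=
  (fun a (i : Fin m) => a i.castSucc) '' A

/-- `(μ, ν, ρ)` is a largely continuous presentation of the set `A ⊆ F_I(Γ^(m+1))`, as a precell
whose last modulus is `n`. -/
structure IsLCPresentation {m : ℕ} (I : Set (Fin (m + 1))) (n : ℕ)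
    (μ ν : (Fin m → Gam G) → Om G) (ρ : ℕ) (A : Set (Fin (m + 1) → Gam G)) : Prop where
  affine_left : IsAffineOn μ (socle A)
  affine_right : IsAffineOn ν (socle A)
  nonneg_left : ∀ x ∈ socle A, 0 ≤ μ x
  nonneg_right : ∀ x ∈ socle A, 0 ≤ ν x
  continuous_left : IsLargelyContinuousOn μ (socle A)
  continuous_right : IsLargelyContinuousOn ν (socle A)
  modulus_lt : ρ < n
  mem_iff : ∀ a : Fin (m + 1) → Gam G, a ∈ A ↔
    gamSupp a = I ∧ (fun i : Fin m => a i.castSucc) ∈ socle A ∧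
      μ (fun i : Fin m => a i.castSucc) ≤ toOm (a (Fin.last m)) ∧
      toOm (a (Fin.last m)) ≤ ν (fun i : Fin m => a i.castSucc) ∧
      GamModEq (a (Fin.last m)) ρ n

/-- Largely continuous precells mod `N` in `Γ^m`, by induction on `m`: the only one in `Γ^0` is
`Γ^0` itself, and `A ⊆ Γ^(m+1)` is one if its socle is so (for the truncated tuple of moduli) and
`A` has a largely continuous presentation. -/
def IsLCPrecell : (m : ℕ) → (Fin m → ℕ) → Set (Fin m → Gam G) → Prop
  | 0, _, A => A = univ
  | m + 1, N, A =>
      IsLCPrecell m (fun i => N i.castSucc) (socle A) ∧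
      ∃ (I : Set (Fin (m + 1))) (μ ν : (Fin m → Gam G) → Om G) (ρ : ℕ),
        IsLCPresentation I (N (Fin.last m)) μ ν ρ A

end ZGroup

/-! ## Polytopes in `K^m` -/

section Field

variable {K : Type u} [Field K] {G : Type w} [AddCommGroup G] [LinearOrder G]
  [IsOrderedAddMonoid G]

/-- The valuation ring `R` of `v`. -/
abbrev valRing (v : AddValuation K (WithTop G)) : ValuationSubring K :=
  (AddValuation.toValuation v).valuationSubring

/-- `(K, v)` is a Henselian valued field of characteristic zero whose residue field is finite and
whose value group `𝒵 = v(K^×)` is a `ℤ`-group. Every `p`-adically closed field is of this kind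
(for which `v(p)` is moreover a finite multiple of the smallest positive element of `𝒵`, a
condition which is not imposed here). -/
structure IsPAdicallyClosed (v : AddValuation K (WithTop G)) : Prop where
  charZero : CharZero K
  henselian : HenselianLocalRing (valRing v)
  finite_residueField : Finite (IsLocalRing.ResidueField (valRing v))
  surjective : Function.Surjective v
  zGroup : IsZGroup G

/-- The topology of `K^m`: the product of the topologies defined by the valuation. -/
abbrev valPiTop (v : AddValuation K (WithTop G)) (m : ℕ) : TopologicalSpace (Fin m → K) :=
  @Pi.topologicalSpace (Fin m) (fun _ => K)
    (fun _ => (Valued.mk' (AddValuation.toValuation v)).toUniformSpace.toTopologicalSpace)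

/-- The topological closure in `K^m`. -/
def valClosure (v : AddValuation K (WithTop G)) {m : ℕ} (A : Set (Fin m → K)) :
    Set (Fin m → K) :=
  @closure _ (valPiTop v m) A

/-- The frontier `∂A`: the closure of `Ā \ A`. -/
def valFrontier (v : AddValuation K (WithTop G)) {m : ℕ} (A : Set (Fin m → K)) :
    Set (Fin m → K) :=
  valClosure v (valClosure v A \ A)

/-- `A` is relatively open: it is open in its closure, that is `Ā \ A` is closed. -/
def IsRelativelyOpen (v : AddValuation K (WithTop G)) {m : ℕ} (A : Set (Fin m → K)) : Prop :=
  @IsClosed _ (valPiTop v m) (valClosure v A \ A)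

/-- The subgroup `Q_{1,M}` of `K^×`: the kernel of the unique group homomorphism
`ac_M : K^× → (R/π^M R)^×` which maps the generator `π` of the maximal ideal to `1` and is the
residue map on units of `R`. As `v(K^×)` is a `ℤ`-group, every element of `K^×` is of the form
`π^l y^c u` with `u` a unit of `R` and `c` the order of `(R/π^M R)^×`, and it is mapped to the
residue of `u`. When `v(K^×) = ℤ` this set is the union of all the `π^k (1 + π^M R)`. -/
def Q1 (v : AddValuation K (WithTop G)) (π : valRing v) (M : ℕ) : Set K :=
  {x | ∃ (l : ℤ) (y : K) (r : valRing v), y ≠ 0 ∧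
    x = (π : K) ^ l * y ^ Nat.card (valRing v ⧸ Ideal.span {π ^ M})ˣ * (1 + (π : K) ^ M * r)}

/-- `D^M R = ({0} ∪ Q_{1,M}) ∩ R`. -/
def DR (v : AddValuation K (WithTop G)) (π : valRing v) (M : ℕ) : Set K :=
  ({0} ∪ Q1 v π M) ∩ {x | x ∈ valRing v}

/-- `D^M R^m`, the set of points of `K^m` all of whose coordinates are in `D^M R`. -/
def DRm (v : AddValuation K (WithTop G)) (π : valRing v) (M m : ℕ) : Set (Fin m → K) :=
  {x | ∀ i, x i ∈ DR v π M}

/-- The map `v = (v, …, v) : K^m → Γ^m`. -/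
def vmap (v : AddValuation K (WithTop G)) {m : ℕ} (x : Fin m → K) : Fin m → Gam G :=
  fun i => v (x i)

/-- `S` is a polytope mod `N` in `D^M R^m`. -/
def IsPolytope (v : AddValuation K (WithTop G)) (π : valRing v) (M : ℕ) {m : ℕ}
    (N : Fin m → ℕ) (S : Set (Fin m → K)) : Prop :=
  IsLCPrecell m N (vmap v '' S) ∧ S = vmap v ⁻¹' (vmap v '' S) ∩ DRm v π M m

/-- `S` is a monotope mod `N` in `D^M R^m`: a polytope whose image by `v` is monohedral. -/
def IsMonotope (v : AddValuation K (WithTop G)) (π : valRing v) (M : ℕ) {m : ℕ}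
    (N : Fin m → ℕ) (S : Set (Fin m → K)) : Prop :=
  IsPolytope v π M N S ∧ IsMonohedral (vmap v '' S)

/-- `F` is a face of `S ⊆ D^M R^m`: the inverse image, by the restriction of `v` to `D^M R^m`, of
a (non-empty) face of `v(S)`. -/
def IsFace (v : AddValuation K (WithTop G)) (π : valRing v) (M : ℕ) {m : ℕ}
    (F S : Set (Fin m → K)) : Prop :=
  ∃ J : Set (Fin m), (gamFace J (vmap v '' S)).Nonempty ∧
    F = vmap v ⁻¹' gamFace J (vmap v '' S) ∩ DRm v π M m

/-- A complex of monotopes mod `N` in `D^M R^m`: a finite family of monotopes such that, for any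
two members `S`, `T`, the intersection of their closures is the union of their common faces. -/
structure IsMonotopeComplex (v : AddValuation K (WithTop G)) (π : valRing v) (M : ℕ) {m : ℕ}
    (N : Fin m → ℕ) (C : Set (Set (Fin m → K))) : Prop where
  monotope : ∀ S ∈ C, IsMonotope v π M N S
  finite : C.Finite
  inter_closure : ∀ S ∈ C, ∀ T ∈ C,
    valClosure v S ∩ valClosure v T = ⋃₀ {F | IsFace v π M F S ∧ IsFace v π M F T}

/-- A subset of `K^m` is semi-algebraic if it is definable, with parameters in `K`, in the
first-order language of rings. -/
def IsSemialgebraic {m : ℕ} (A : Set (Fin m → K)) : Prop :=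
  letI := FirstOrder.Ring.compatibleRingOfRing K
  (Set.univ : Set K).Definable FirstOrder.Language.ring A

end Field

end PadicPolytope

end

/-!
The valuation `v : D^M R^m → Γ^m` is continuous, and it lifts approximations, so that the problem is
read in `Γ^m`. In a complex of monotopes with union `A`, each face of a monotope `S` is either a
member of the complex, hence contained in `A`, or disjoint from `A`. As the faces of `S` form a
chain and `Ā \ A` is closed, the faces outside `A` are those whose support is contained in that of
the largest one, `J = ⋃₀ boundarySupports v A S`. Moreover `J` is the same for two monotopes one of
which accumulates at a point of the other (`IsMonotopeComplex.boundarySupports_eq`). It follows that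
`δ(x) = min {v(x_i) | i ∉ J}`, for `x ∈ S`, is a well-defined and locally constant function of `x` in
the part of `A` which has a boundary; it measures how far `x` is from `Ā \ A`.

The piece of index `k` consists of the points `x` such that `δ(x)` is, modulo `n B`, in
`[k B, (k + 1) B)`, for a suitable integer `B`. The pieces are closed in `A` since `δ` is locally
constant, and the point is that each of them accumulates at every point `y` of `Ā \ A`. This rests on
`IsLCPrecell.exists_isDirection`: if `y` is in the closure of a largely continuous precell `P`, then
`P` is stable under translation by the non-negative multiples of some integer vector `w` whose
non-zero coordinates are positive and are exactly those at which `y` is infinite. The vector is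
built coordinate by coordinate: the bounds `μ`, `ν` of the last coordinate have a rational slope along
the direction already built, and their non-negativity and continuity at `y` make these slopes
compatible with a choice of the last coordinate of `w`. Starting from a point of `S` near `y` and
multiplying its coordinates by powers of `π`, one follows the direction `w`; then `δ` increases by
steps between `1` and the largest coordinate of `w`, so that it meets every block as soon as `B`
bounds the coordinates of the finitely many vectors `w` which are needed.

The pieces are semi-algebraic because the valuation ring is: `x ∈ R` if and only if `1 + π x ^ l` is
an `l`-th power, where `l - 1` is the number of elements of the residue field.
-/

namespace PadicPolytope

/-! ### The topology of `Γ^m` -/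

section GammaTopology

variable {G : Type*} [AddCommGroup G] [LinearOrder G] [IsOrderedAddMonoid G] {m : ℕ}

/-- The basic neighbourhood of `y` in `Γ^m` with parameter `c`: the finite coordinates are those of
`y`, and the coordinates which are infinite in `y` are larger than `c`. -/
def gamNear (c : G) (y : Fin m → Gam G) : Set (Fin m → Gam G) :=
  {x | ∀ i, (y i ≠ ⊤ → x i = y i) ∧ (y i = ⊤ → (c : WithTop G) < x i)}

omit [IsOrderedAddMonoid G] in
theorem IsZGroup.exists_pos (hG : IsZGroup G) : ∃ e : G, 0 < e :=
  hG.exists_least_pos.imp fun _ he => he.1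

theorem IsLeast.add_le_of_lt {e : G} (he : IsLeast {x : G | 0 < x} e) {a b : G} (h : a < b) :
    a + e ≤ b := by
  have := he.2 (show b - a ∈ {x : G | 0 < x} from sub_pos.2 h)
  rw [add_comm]
  exact le_sub_iff_add_le.1 this

theorem IsZGroup.nhds_coe (hG : IsZGroup G) (g : G) :
    @nhds _ (gamTop G) (g : WithTop G) = pure (g : WithTop G) := by
  let _ := gamTop G
  have : OrderTopology (Gam G) := ⟨rfl⟩
  obtain ⟨e, he⟩ := hG.exists_least_pos
  refine le_antisymm ?_ (pure_le_nhds _)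
  rw [Filter.le_pure_iff]
  have h0 : (0 : G) < e := he.1
  have h1 : Ioo (((g - e : G) : WithTop G)) ((g + e : G) : WithTop G) ∈ nhds (g : WithTop G) :=
    Ioo_mem_nhds (by exact_mod_cast sub_lt_self g h0) (by exact_mod_cast lt_add_of_pos_right g h0)
  filter_upwards [h1] with x hx
  induction x using WithTop.recTopCoe with
  | top => exact absurd hx.2 (by simp)
  | coe x =>
    have hx1 : g - e < x := by exact_mod_cast hx.1
    have hx2 : x < g + e := by exact_mod_cast hx.2
    rcases lt_trichotomy x g with h | h | h
    · have := IsLeast.add_le_of_lt he h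
      exact absurd (sub_lt_iff_lt_add.1 hx1) (not_lt.2 this)
    · simp [h]
    · exact absurd hx2 (not_lt.2 (IsLeast.add_le_of_lt he h))

omit [IsOrderedAddMonoid G] in
theorem mem_nhds_top {U : Set (Gam G)} :
    U ∈ @nhds _ (gamTop G) (⊤ : WithTop G) ↔ ∃ c : G, Ioi (c : WithTop G) ⊆ U := by
  let _ := gamTop G
  have : OrderTopology (Gam G) := ⟨rfl⟩
  rw [(nhds_top_basis (α := Gam G)).mem_iff]
  constructor
  · rintro ⟨a, ha, h⟩
    lift a to G using ha.ne
    exact ⟨a, h⟩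
  · rintro ⟨c, h⟩
    exact ⟨c, WithTop.coe_lt_top c, h⟩

theorem IsZGroup.mem_nhds (hG : IsZGroup G) {y : Fin m → Gam G} {U : Set (Fin m → Gam G)} :
    U ∈ @nhds _ (gamPiTop G m) y ↔ ∃ c : G, gamNear c y ⊆ U := by
  let _ := gamTop G
  rw [nhds_pi]
  constructor
  · intro h
    obtain ⟨I, -, t, ht, hU⟩ := Filter.mem_pi.1 h
    have : ∀ i, ∃ c : G, (y i ≠ ⊤ → y i ∈ t i) ∧ (y i = ⊤ → Ioi (c : WithTop G) ⊆ t i) := by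
      intro i
      by_cases hy : y i = ⊤
      · have := ht i
        rw [hy] at this
        obtain ⟨c, hc⟩ := mem_nhds_top.1 this
        exact ⟨c, fun h => absurd hy h, fun _ => hc⟩
      · exact ⟨0, fun _ => mem_of_mem_nhds (ht i), fun h => absurd h hy⟩
    choose c hc using this
    obtain ⟨M, hM⟩ := Finite.exists_le c
    refine ⟨M, fun x hx => hU fun i _ => ?_⟩
    by_cases hy : y i = ⊤
    · refine (hc i).2 hy (lt_of_le_of_lt ?_ ((hx i).2 hy))
      exact_mod_cast hM i
    · rw [(hx i).1 hy]
      exact (hc i).1 hy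
  · rintro ⟨c, hc⟩
    have h : (univ : Set (Fin m)).pi (fun i => {z : Gam G | (y i ≠ ⊤ → z = y i) ∧
        (y i = ⊤ → (c : WithTop G) < z)}) ∈ Filter.pi fun i => nhds (y i) := by
      refine Filter.pi_mem_pi finite_univ fun i _ => ?_
      by_cases hy : y i = ⊤
      · rw [hy, mem_nhds_top]
        exact ⟨c, fun z hz => ⟨fun h => absurd rfl h, fun _ => hz⟩⟩
      · obtain ⟨g, hg⟩ := WithTop.ne_top_iff_exists.1 hy
        rw [← hg, hG.nhds_coe]
        exact ⟨fun _ => rfl, fun h => absurd h (by simp)⟩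
    exact Filter.mem_of_superset h fun x hx => hc fun i => hx i (mem_univ i)

theorem IsZGroup.mem_closure (hG : IsZGroup G) {y : Fin m → Gam G} {A : Set (Fin m → Gam G)} :
    y ∈ gamClosure A ↔ ∀ c : G, ∃ x ∈ A, x ∈ gamNear c y := by
  rw [gamClosure, @mem_closure_iff_nhds _ (gamPiTop G m)]
  constructor
  · intro h c
    obtain ⟨x, hx, hA⟩ := h _ (hG.mem_nhds.2 ⟨c, Subset.rfl⟩)
    exact ⟨x, hA, hx⟩
  · intro h U hU
    obtain ⟨c, hc⟩ := hG.mem_nhds.1 hU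
    obtain ⟨x, hA, hx⟩ := h c
    exact ⟨x, hc hx, hA⟩

end GammaTopology

/-! ### Translations preserving a precell -/

section Directions

variable {G : Type*} [AddCommGroup G] [LinearOrder G] [IsOrderedAddMonoid G] {m : ℕ}

/-- The translation `x ↦ x + k w` of `Γ^m` by the multiple `k ∈ 𝒵` of the integer vector `w`;
infinite coordinates are unchanged. -/
def gamShift (w : Fin m → ℕ) (k : G) (x : Fin m → Gam G) : Fin m → Gam G :=
  fun i => x i + ((w i • k : G) : WithTop G)

/-- The vector `w` is a direction of `P` towards `y`: it is supported exactly on the infinite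
coordinates of `y`, and `P` is stable under the translations by its non-negative multiples. -/
structure IsDirection (P : Set (Fin m → Gam G)) (y : Fin m → Gam G) (w : Fin m → ℕ) : Prop where
  eq_zero : ∀ i, y i ≠ ⊤ → w i = 0
  pos : ∀ i, y i = ⊤ → 0 < w i
  shift_mem : ∀ x ∈ P, ∀ k : G, 0 ≤ k → gamShift w k x ∈ P

omit [LinearOrder G] [IsOrderedAddMonoid G] in
theorem gamShift_zero (w : Fin m → ℕ) (x : Fin m → Gam G) : gamShift w (0 : G) x = x := by
  funext i
  simp [gamShift]

omit [LinearOrder G] [IsOrderedAddMonoid G] in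
theorem gamShift_smul (w : Fin m → ℕ) (t : ℕ) (k : G) (x : Fin m → Gam G) :
    gamShift (fun i => t * w i) k x = gamShift w (t • k) x := by
  funext i
  simp only [gamShift, mul_comm t, mul_smul]

omit [LinearOrder G] [IsOrderedAddMonoid G] in
theorem gamSupp_gamShift (w : Fin m → ℕ) (k : G) (x : Fin m → Gam G) :
    gamSupp (gamShift w k x) = gamSupp x := by
  ext i
  simp only [gamSupp, gamShift, mem_ofPred_eq, ne_eq, WithTop.add_eq_top, WithTop.coe_ne_top, or_false]

theorem gamShift_mem_gamNear {w : Fin m → ℕ} {y : Fin m → Gam G} (hw : ∀ i, y i ≠ ⊤ → w i = 0)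
    {x : Fin m → Gam G} {c : G} (hx : x ∈ gamNear c y) {k : G} (hk : 0 ≤ k) :
    gamShift w k x ∈ gamNear c y := by
  intro i
  refine ⟨fun h => ?_, fun h => ?_⟩
  · simp [gamShift, hw i h, (hx i).1 h]
  · refine lt_of_lt_of_le ((hx i).2 h) ?_
    have : (0 : WithTop G) ≤ ((w i • k : G) : WithTop G) := by
      exact_mod_cast nsmul_nonneg hk _
    exact le_add_of_nonneg_right this

/-- Far enough along a direction towards `y`, one is arbitrarily close to `y`. -/
theorem exists_gamShift_mem_gamNear {w : Fin m → ℕ} {y : Fin m → Gam G} {x : Fin m → Gam G}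
    (hw0 : ∀ i, y i ≠ ⊤ → w i = 0) (hw : ∀ i, y i = ⊤ → 0 < w i) {e : G} (he : 0 < e)
    (hx : ∀ i, y i ≠ ⊤ → x i = y i) (c : G) :
    ∃ k : G, 0 ≤ k ∧ gamShift w k x ∈ gamNear c y := by
  obtain ⟨M, hM⟩ := Finite.exists_le fun i => c - (x i).untopD 0
  refine ⟨max M 0 + e, add_nonneg (le_max_right _ _) he.le, fun i => ⟨fun h => ?_, fun h => ?_⟩⟩
  · simp [gamShift, hw0 i h, hx i h]
  · by_cases hxi : x i = ⊤
    · simp [gamShift, hxi]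
    · obtain ⟨a, ha⟩ := WithTop.ne_top_iff_exists.1 hxi
      have h1 := hM i
      simp only [← ha, WithTop.untopD_coe] at h1
      simp only [gamShift, ← ha]
      have h2 : max M 0 + e ≤ w i • (max M 0 + e) :=
        by
          simpa using nsmul_le_nsmul_left (add_nonneg (le_max_right M 0) he.le) (hw i h)
      have h3 : c < a + w i • (max M 0 + e) := by
        calc c ≤ a + M := by rwa [← sub_le_iff_le_add']
          _ ≤ a + max M 0 := by gcongr; exact le_max_left _ _
          _ < a + (max M 0 + e) := by gcongr; exact lt_add_of_pos_right _ he
          _ ≤ _ := by gcongr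
      exact_mod_cast h3

theorem DivisibleHull.exists_le_coe (b : DivisibleHull G) :
    ∃ g : G, 0 ≤ g ∧ b ≤ DivisibleHull.coe g := by
  induction b with
  | mk z s =>
    refine ⟨|z|, abs_nonneg z, ?_⟩
    rw [DivisibleHull.mk_le_mk]
    simpa using (le_abs_self z).trans (by simpa using nsmul_le_nsmul_left (abs_nonneg z) (Nat.succ_le_of_lt s.pos))

theorem DivisibleHull.coe_le_coe {a b : G} :
    (DivisibleHull.coe a : DivisibleHull G) ≤ DivisibleHull.coe b ↔ a ≤ b := by
  simp

omit [LinearOrder G] [IsOrderedAddMonoid G] in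
theorem DivisibleHull.coe_nsmul (t : ℕ) (k : G) :
    (DivisibleHull.coe (t • k) : DivisibleHull G) = (t : ℚ) • DivisibleHull.coe k := by
  rw [Nat.cast_smul_eq_nsmul]
  exact map_nsmul (DivisibleHull.coeAddMonoidHom G) t k

/-- An affine function of positive slope is unbounded. -/
theorem exists_lt_add_smul {e : G} (he : 0 < e) {q : ℚ} (hq : 0 < q) (b B : DivisibleHull G) :
    ∃ k : G, 0 ≤ k ∧ B < b + q • (DivisibleHull.coe k : DivisibleHull G) := by
  obtain ⟨g, hg0, hg⟩ := DivisibleHull.exists_le_coe (B - b)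
  have hk : (0 : G) ≤ g + e := add_nonneg hg0 he.le
  refine ⟨q.den • (g + e), nsmul_nonneg hk _, ?_⟩
  rw [DivisibleHull.coe_nsmul, smul_smul, Rat.mul_den_eq_num]
  have hnum : (1 : ℚ) ≤ (q.num : ℚ) := by
    exact_mod_cast Int.add_one_le_iff.2 (Rat.num_pos.2 hq)
  have h1 : (DivisibleHull.coe (g + e) : DivisibleHull G) ≤
      (q.num : ℚ) • DivisibleHull.coe (g + e) := by
    have h0 : (0 : DivisibleHull G) ≤ DivisibleHull.coe (g + e) := by
      have := DivisibleHull.coe_le_coe.2 hk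
      simpa using this
    simpa using smul_le_smul_of_nonneg_right hnum h0
  have h2 : (DivisibleHull.coe g : DivisibleHull G) < DivisibleHull.coe (g + e) := by
    rw [lt_iff_not_ge, DivisibleHull.coe_le_coe, not_le]
    exact lt_add_of_pos_right _ he
  have h3 := (hg.trans_lt h2).trans_le h1
  rwa [sub_lt_iff_lt_add'] at h3

/-- An affine function of bounded-below values along a ray has non-negative slope. -/
theorem slope_nonneg {e : G} (he : 0 < e) {q : ℚ} {b B : DivisibleHull G}
    (h : ∀ k : G, 0 ≤ k → B ≤ b + q • (DivisibleHull.coe k : DivisibleHull G)) : 0 ≤ q := by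
  by_contra! hq
  obtain ⟨k, hk, hlt⟩ := exists_lt_add_smul he (neg_pos.2 hq) (-b) (-B)
  have := h k hk
  rw [neg_smul, ← neg_add, neg_lt_neg_iff] at hlt
  exact absurd this (not_le.2 hlt)

/-- A function which is affine on a set of constant support either is constantly `+∞`, or has a
well-defined slope along any direction. -/
theorem IsAffineOn.exists_slope {f : (Fin m → Gam G) → Om G} {P : Set (Fin m → Gam G)}
    (hf : IsAffineOn f P) {I : Set (Fin m)} (hI : ∀ a ∈ P, gamSupp a = I) {w : Fin m → ℕ}
    (hw : ∀ a ∈ P, ∀ k : G, 0 ≤ k → gamShift w k a ∈ P) :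
    (∀ a ∈ P, f a = ⊤) ∨ ∃ q : ℚ, ∀ a ∈ P, ∃ b : DivisibleHull G, ∀ k : G, 0 ≤ k →
      f (gamShift w k a) =
        ((b + q • DivisibleHull.coe k : DivisibleHull G) : WithTop (DivisibleHull G)) := by
  classical
  refine hf.imp id ?_
  rintro ⟨α₀, α, hα⟩
  refine ⟨∑ i, if i ∈ I then α i * w i else 0, fun a ha =>
    ⟨α₀ + ∑ i, α i • (DivisibleHull.coe ((a i).untopD 0) : DivisibleHull G), fun k hk => ?_⟩⟩
  rw [hα _ (hw a ha k hk), add_assoc, Finset.sum_smul, ← Finset.sum_add_distrib]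
  refine congrArg (fun t : DivisibleHull G => ((α₀ + t : DivisibleHull G) :
    WithTop (DivisibleHull G))) (Finset.sum_congr rfl fun i _ => ?_)
  have hiI : i ∈ I ↔ a i ≠ ⊤ := by rw [← hI a ha]; rfl
  by_cases hi : a i = ⊤
  · simp [gamShift, hi, hiI]
  · obtain ⟨g, hg⟩ := WithTop.ne_top_iff_exists.1 hi
    rw [if_pos (hiI.2 hi)]
    simp only [gamShift, ← hg]
    rw [← WithTop.coe_add, WithTop.untopD_coe, WithTop.untopD_coe, DivisibleHull.coe_add,
      DivisibleHull.coe_nsmul, smul_add, smul_smul]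

end Directions

section Precells

variable {G : Type*} [AddCommGroup G] [LinearOrder G] [IsOrderedAddMonoid G] {m : ℕ}

omit [AddCommGroup G] [LinearOrder G] [IsOrderedAddMonoid G] in
theorem gamSupp_socle {I : Set (Fin (m + 1))} {P : Set (Fin (m + 1) → Gam G)}
    (hI : ∀ a ∈ P, gamSupp a = I) :
    ∀ a ∈ socle P, gamSupp a = Fin.castSucc ⁻¹' I := by
  rintro _ ⟨a, ha, rfl⟩
  rw [← hI a ha]
  rfl

/-- All the points of a precell have the same support. -/
theorem IsLCPrecell.exists_supp {N : Fin m → ℕ} {P : Set (Fin m → Gam G)}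
    (hP : IsLCPrecell m N P) : ∃ I, ∀ a ∈ P, gamSupp a = I := by
  cases m with
  | zero => exact ⟨∅, fun a _ => Set.eq_empty_of_isEmpty _⟩
  | succ m =>
    obtain ⟨-, I, μ, ν, ρ, h⟩ := hP
    exact ⟨I, fun a ha => ((h.mem_iff a).1 ha).1⟩

/-- An upper bound for the values near `y` of a largely continuous function, from an upper bound
at points of the set arbitrarily close to `y`. -/
theorem IsLargelyContinuousOn.exists_forall_lt (hG : IsZGroup G) {f : (Fin m → Gam G) → Om G}
    {P : Set (Fin m → Gam G)} (hf : IsLargelyContinuousOn f P) {y : Fin m → Gam G}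
    (hy : y ∈ gamClosure P) {B B' : Om G} (hB : B < B')
    (h : ∀ c : G, ∃ x ∈ P, x ∈ gamNear c y ∧ f x ≤ B) :
    ∃ c : G, ∀ x ∈ P, x ∈ gamNear c y → f x < B' := by
  obtain ⟨g, hg, hgf⟩ := hf
  let _ := gamPiTop G m
  let _ := omTop G
  have : OrderTopology (Om G) := ⟨rfl⟩
  have key : ∀ V ∈ nhds (g y), ∃ c : G, ∀ x ∈ P, x ∈ gamNear c y → f x ∈ V := by
    intro V hV
    have h1 := hg y hy hV
    rw [Filter.mem_map, mem_nhdsWithin_iff_exists_mem_nhds_inter] at h1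
    obtain ⟨U, hU, hUV⟩ := h1
    obtain ⟨c, hc⟩ := hG.mem_nhds.1 hU
    refine ⟨c, fun x hx hxc => ?_⟩
    have := hUV ⟨hc hxc, subset_closure hx⟩
    rwa [mem_preimage, hgf hx] at this
  have hgy : g y ≤ B := by
    by_contra! hlt
    obtain ⟨c, hc⟩ := key _ (Ioi_mem_nhds hlt)
    obtain ⟨x, hx, hxc, hxB⟩ := h c
    exact absurd (hc x hx hxc) (not_lt.2 hxB)
  exact key _ (Iio_mem_nhds (hgy.trans_lt hB))

omit [LinearOrder G] [IsOrderedAddMonoid G] in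
theorem toOm_coe (g : G) :
    toOm (g : WithTop G) = ((DivisibleHull.coe g : DivisibleHull G) : WithTop (DivisibleHull G)) :=
  rfl

theorem toOm_le_toOm_coe {a : Gam G} {b : G} : toOm a ≤ toOm (b : WithTop G) ↔ a ≤ b := by
  induction a using WithTop.recTopCoe with
  | top => simp [toOm]
  | coe a => simp [toOm_coe]

omit [AddCommGroup G] [IsOrderedAddMonoid G] in
theorem gamNear_mono {c c' : G} (h : c ≤ c') {y : Fin m → Gam G} :
    gamNear c' y ⊆ gamNear c y :=
  fun _ hx i => ⟨(hx i).1, fun hy => lt_of_le_of_lt (by exact_mod_cast h) ((hx i).2 hy)⟩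

omit [AddCommGroup G] [IsOrderedAddMonoid G] in
theorem gamNear_init {c : G} {x y : Fin (m + 1) → Gam G} (h : x ∈ gamNear c y) :
    (fun i : Fin m => x i.castSucc) ∈ gamNear c fun i : Fin m => y i.castSucc :=
  fun i => h i.castSucc

theorem init_mem_gamClosure_socle (hG : IsZGroup G) {P : Set (Fin (m + 1) → Gam G)}
    {y : Fin (m + 1) → Gam G} (hy : y ∈ gamClosure P) :
    (fun i : Fin m => y i.castSucc) ∈ gamClosure (socle P) := by
  rw [hG.mem_closure] at hy ⊢
  intro c
  obtain ⟨x, hx, hxc⟩ := hy c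
  exact ⟨_, ⟨x, hx, rfl⟩, gamNear_init hxc⟩

theorem GamModEq.add_smul {z : Gam G} {ρ n s : ℕ} (h : GamModEq z ρ n) (hs : n ∣ s) (k : G) :
    GamModEq (z + ((s • k : G) : WithTop G)) ρ n := by
  induction z using WithTop.recTopCoe with
  | top => intro x hx; simp at hx
  | coe z =>
    intro x hx
    obtain ⟨e, b, he, hb⟩ := h z rfl
    obtain ⟨t, rfl⟩ := hs
    refine ⟨e, b + t • k, he, ?_⟩
    have : x = z + (n * t) • k := by exact_mod_cast hx.symm
    rw [this, hb, smul_add, mul_smul, add_assoc]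

/-- Extension of a direction of the socle to a direction of the precell: it suffices to choose a
last coordinate `s` which is compatible with the bounds `μ`, `ν` and with the modulus. -/
theorem IsLCPresentation.isDirection_snoc {I : Set (Fin (m + 1))} {n : ℕ}
    {μ ν : (Fin m → Gam G) → Om G} {ρ : ℕ} {P : Set (Fin (m + 1) → Gam G)}
    (h : IsLCPresentation I n μ ν ρ P) {y : Fin (m + 1) → Gam G} {w : Fin m → ℕ}
    (hw : IsDirection (socle P) (fun i : Fin m => y i.castSucc) w) {t s : ℕ} (ht : 0 < t)
    (hs0 : y (Fin.last m) ≠ ⊤ → s = 0) (hs : y (Fin.last m) = ⊤ → 0 < s)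
    (hbound : ∀ x ∈ P, ∀ k : G, 0 ≤ k →
      μ (gamShift w (t • k) fun i : Fin m => x i.castSucc) ≤
        toOm (x (Fin.last m) + ((s • k : G) : WithTop G)) ∧
      toOm (x (Fin.last m) + ((s • k : G) : WithTop G)) ≤
        ν (gamShift w (t • k) fun i : Fin m => x i.castSucc))
    (hn : Fin.last m ∈ I → n ∣ s) :
    IsDirection P y (Fin.snoc (fun i => t * w i) s : Fin (m + 1) → ℕ) := by
  refine ⟨fun i => ?_, fun i => ?_, fun x hx k hk => ?_⟩
  · induction i using Fin.lastCases with
    | last => simpa using hs0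
    | cast i =>
      intro hi
      simp [hw.eq_zero i hi]
  · induction i using Fin.lastCases with
    | last => simpa using hs
    | cast i =>
      intro hi
      simp [hw.pos i hi, ht]
  · have hinit : (fun i : Fin m => gamShift (Fin.snoc (fun i => t * w i) s : Fin (m + 1) → ℕ) k x
        i.castSucc) = gamShift w (t • k) fun i : Fin m => x i.castSucc := by
      rw [← gamShift_smul]
      funext i
      simp [gamShift]
    have hlast : gamShift (Fin.snoc (fun i => t * w i) s : Fin (m + 1) → ℕ) k x (Fin.last m) =
        x (Fin.last m) + ((s • k : G) : WithTop G) := by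
      simp only [gamShift, Fin.snoc_last]
    have hx' := (h.mem_iff x).1 hx
    rw [h.mem_iff, hinit, hlast, gamSupp_gamShift]
    refine ⟨hx'.1, hw.shift_mem _ hx'.2.1 _ (nsmul_nonneg hk _), (hbound x hx k hk).1,
      (hbound x hx k hk).2, ?_⟩
    by_cases hI : Fin.last m ∈ I
    · exact hx'.2.2.2.2.add_smul (hn hI) k
    · have : x (Fin.last m) = ⊤ := by
        by_contra hne
        exact hI (hx'.1 ▸ hne)
      intro z hz
      simp [this] at hz

/-- **Existence of directions.** A largely continuous precell `P` is stable under translation by an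
integer vector pointing exactly towards any given point `y` of its closure. -/
theorem IsLCPrecell.exists_isDirection (hG : IsZGroup G) : ∀ {m : ℕ} {N : Fin m → ℕ}
    (_ : ∀ i, 1 ≤ N i) {P : Set (Fin m → Gam G)} (_ : IsLCPrecell m N P) {y : Fin m → Gam G}
    (_ : y ∈ gamClosure P), ∃ w, IsDirection P y w := by
  intro m
  induction m with
  | zero =>
    intro N _ P hP y _
    refine ⟨fun _ => 0, fun i => i.elim0, fun i => i.elim0, fun x _ k _ => ?_⟩
    rw [show P = univ from hP]
    trivial
  | succ m ih =>
    rintro N hN P ⟨hsoc, I, μ, ν, ρ, h⟩ y hy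
    obtain ⟨e, he⟩ := hG.exists_pos
    have hy' := init_mem_gamClosure_socle hG hy
    obtain ⟨w, hw⟩ := ih (fun i => hN i.castSucc) hsoc hy'
    have hsupp : ∀ a ∈ P, gamSupp a = I := fun a ha => ((h.mem_iff a).1 ha).1
    have hbd : ∀ x ∈ P, (fun i : Fin m => x i.castSucc) ∈ socle P ∧
        μ (fun i : Fin m => x i.castSucc) ≤ toOm (x (Fin.last m)) ∧
        toOm (x (Fin.last m)) ≤ ν (fun i : Fin m => x i.castSucc) :=
      fun x hx => ⟨⟨x, hx, rfl⟩, ((h.mem_iff x).1 hx).2.2.1, ((h.mem_iff x).1 hx).2.2.2.1⟩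
    obtain ⟨x₀, hx₀, -⟩ := (hG.mem_closure.1 hy) 0
    have hμν : ∀ x ∈ socle P, μ x ≤ ν x := by
      rintro _ ⟨x, hx, rfl⟩
      exact (hbd x hx).2.1.trans (hbd x hx).2.2
    by_cases hI : Fin.last m ∈ I
    swap
    · -- the last coordinate is infinite on `P`: there is no constraint on it
      have htop : ∀ x ∈ P, x (Fin.last m) = ⊤ := by
        intro x hx
        by_contra hne
        exact hI (hsupp x hx ▸ hne)
      have hyt : y (Fin.last m) = ⊤ := by
        by_contra hne
        obtain ⟨x, hx, hxc⟩ := (hG.mem_closure.1 hy) 0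
        exact hne (((hxc _).1 hne).symm.trans (htop x hx))
      refine ⟨_, h.isDirection_snoc hw (t := 1) (s := 1) one_pos (fun h => absurd hyt h)
        (fun _ => one_pos) (fun x hx k hk => ?_) fun h => absurd h hI⟩
      obtain ⟨a, ha, hax⟩ := hw.shift_mem _ (hbd x hx).1 (1 • k) (nsmul_nonneg hk 1)
      have := (hbd a ha).2.2
      rw [← hax]
      rw [htop a ha] at this
      rw [htop x hx]
      exact ⟨le_top, this⟩
    have hfin : ∀ x ∈ P, ∃ z : G, x (Fin.last m) = (z : WithTop G) := fun x hx => by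
      have : x (Fin.last m) ≠ ⊤ := by
        have : Fin.last m ∈ gamSupp x := by rwa [hsupp x hx]
        exact this
      exact (WithTop.ne_top_iff_exists.1 this).imp fun _ h => h.symm
    -- the slope `q` of `μ` is non-negative
    obtain ⟨q, hq⟩ := (h.affine_left.exists_slope (gamSupp_socle hsupp) hw.shift_mem).resolve_left
      fun htop => by
        obtain ⟨z, hz⟩ := hfin x₀ hx₀
        have := (hbd x₀ hx₀).2.1
        rw [htop _ (hbd x₀ hx₀).1, hz] at this
        exact absurd this (by simp [toOm_coe])
    have hq0 : 0 ≤ q := by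
      obtain ⟨b, hb⟩ := hq _ (hbd x₀ hx₀).1
      refine slope_nonneg he (b := b) (B := 0) fun k hk => ?_
      have := h.nonneg_left _ (hw.shift_mem _ (hbd x₀ hx₀).1 k hk)
      rw [hb k hk] at this
      exact_mod_cast this
    have hνs := h.affine_right.exists_slope (gamSupp_socle hsupp) hw.shift_mem
    have hr0 : ∀ r : ℚ, (∀ a ∈ socle P, ∃ b : DivisibleHull G, ∀ k : G, 0 ≤ k →
        ν (gamShift w k a) =
          ((b + r • DivisibleHull.coe k : DivisibleHull G) : WithTop (DivisibleHull G))) →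
        0 ≤ r := by
      intro r hr
      obtain ⟨b, hb⟩ := hr _ (hbd x₀ hx₀).1
      refine slope_nonneg he (b := b) (B := 0) fun k hk => ?_
      have := h.nonneg_right _ (hw.shift_mem _ (hbd x₀ hx₀).1 k hk)
      rw [hb k hk] at this
      exact_mod_cast this
    have hcoe0 : ∀ k : G, 0 ≤ k → (0 : DivisibleHull G) ≤ DivisibleHull.coe k := by
      intro k hk
      simpa using DivisibleHull.coe_le_coe.2 hk
    have hNpos : 0 < N (Fin.last m) := hN _
    by_cases hyl : y (Fin.last m) = ⊤
    swap
    · -- the last coordinate stays finite near `y`, so that `μ` is bounded there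
      obtain ⟨z, hz⟩ := WithTop.ne_top_iff_exists.1 hyl
      obtain ⟨c, hc⟩ := h.continuous_left.exists_forall_lt hG hy'
        (B := toOm (z : WithTop G)) (B' := toOm ((z + e : G) : WithTop G))
        (by
          rw [lt_iff_not_ge, toOm_le_toOm_coe, not_le]
          exact_mod_cast lt_add_of_pos_right z he)
        (fun c => by
          obtain ⟨x, hx, hxc⟩ := hG.mem_closure.1 hy c
          refine ⟨_, (hbd x hx).1, gamNear_init hxc, ?_⟩
          rw [hz, ← (hxc _).1 hyl]
          exact (hbd x hx).2.1)
      have hq1 : q = 0 := by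
        refine le_antisymm (not_lt.1 fun hqpos => ?_) hq0
        obtain ⟨x, hx, hxc⟩ := hG.mem_closure.1 hy c
        obtain ⟨b, hb⟩ := hq _ (hbd x hx).1
        obtain ⟨k, hk, hlt⟩ := exists_lt_add_smul he hqpos b (DivisibleHull.coe (z + e))
        have h1 := hc _ (hw.shift_mem _ (hbd x hx).1 k hk)
          (gamShift_mem_gamNear hw.eq_zero (gamNear_init hxc) hk)
        rw [hb k hk, toOm_coe, WithTop.coe_lt_coe] at h1
        exact lt_asymm h1 hlt
      subst hq1
      refine ⟨_, h.isDirection_snoc hw (t := 1) (s := 0) one_pos (fun _ => rfl)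
        (fun h => absurd h hyl) (fun x hx k hk => ?_) fun _ => dvd_zero _⟩
      obtain ⟨hxs, hxμ, hxν⟩ := hbd x hx
      simp only [one_smul, zero_smul, WithTop.coe_zero, add_zero]
      constructor
      · obtain ⟨b, hb⟩ := hq _ hxs
        have hb0 := hb 0 le_rfl
        rw [gamShift_zero] at hb0
        rw [hb k hk]
        rw [hb0] at hxμ
        simpa using hxμ
      · rcases hνs with hν | ⟨r, hr⟩
        · rw [hν _ (hw.shift_mem _ hxs k hk)]
          exact le_top
        · obtain ⟨b, hb⟩ := hr _ hxs
          have hb0 := hb 0 le_rfl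
          rw [gamShift_zero] at hb0
          rw [hb k hk]
          rw [hb0] at hxν
          refine hxν.trans (WithTop.coe_le_coe.2 ?_)
          have := smul_nonneg (hr0 r hr) (hcoe0 k hk)
          simpa using this
    have hlow : ∀ t s : ℕ, q * t ≤ s → ∀ x ∈ P, ∀ k : G, 0 ≤ k →
        μ (gamShift w (t • k) fun i : Fin m => x i.castSucc) ≤
          toOm (x (Fin.last m) + ((s • k : G) : WithTop G)) := by
      intro t s hts x hx k hk
      obtain ⟨hxs, hxμ, -⟩ := hbd x hx
      obtain ⟨b, hb⟩ := hq _ hxs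
      obtain ⟨z, hz⟩ := hfin x hx
      have hb0 := hb 0 le_rfl
      rw [gamShift_zero] at hb0
      rw [hb0, hz, toOm_coe, WithTop.coe_le_coe] at hxμ
      rw [hb _ (nsmul_nonneg hk t), hz, ← WithTop.coe_add, toOm_coe, WithTop.coe_le_coe,
        DivisibleHull.coe_add, DivisibleHull.coe_nsmul, DivisibleHull.coe_nsmul, smul_smul]
      exact add_le_add (by simpa using hxμ) (smul_le_smul_of_nonneg_right hts (hcoe0 k hk))
    rcases hνs with hν | ⟨r, hr⟩
    · -- no upper bound: a large multiple of the modulus will do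
      obtain ⟨s, hs⟩ := exists_nat_ge q
      refine ⟨_, h.isDirection_snoc hw (t := 1) (s := N (Fin.last m) * (s + 1)) one_pos
        (fun h => absurd hyl h) (fun _ => by positivity) (fun x hx k hk => ⟨?_, ?_⟩)
        fun _ => dvd_mul_right _ _⟩
      · refine hlow _ _ ?_ x hx k hk
        have h1 : s ≤ N (Fin.last m) * (s + 1) :=
          (Nat.le_succ s).trans (Nat.le_mul_of_pos_left _ hNpos)
        have h2 : (s : ℚ) ≤ ((N (Fin.last m) * (s + 1) : ℕ) : ℚ) := by exact_mod_cast h1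
        rw [Nat.cast_one, mul_one]
        exact hs.trans h2
      · rw [hν _ (hw.shift_mem _ (hbd x hx).1 _ (nsmul_nonneg hk 1))]
        exact le_top
    · -- `ν` tends to `+∞` at `y`, so that its slope is positive
      have hrpos : 0 < r := by
        refine lt_of_le_of_ne (hr0 r hr) fun hr1 => ?_
        subst hr1
        obtain ⟨x, hx, hxc⟩ := hG.mem_closure.1 hy 0
        obtain ⟨b, hb⟩ := hr _ (hbd x hx).1
        obtain ⟨g, -, hg⟩ := DivisibleHull.exists_le_coe b
        obtain ⟨c, hc⟩ := h.continuous_right.exists_forall_lt hG hy'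
          (B := (b : WithTop (DivisibleHull G))) (B' := toOm ((g + e : G) : WithTop G))
          (by
            rw [toOm_coe, WithTop.coe_lt_coe]
            refine hg.trans_lt ?_
            rw [lt_iff_not_ge, DivisibleHull.coe_le_coe, not_le]
            exact lt_add_of_pos_right g he)
          (fun c => by
            obtain ⟨k, hk, hkc⟩ := exists_gamShift_mem_gamNear hw.eq_zero hw.pos he
              (x := fun i : Fin m => x i.castSucc) (fun i hi => (hxc i.castSucc).1 hi) c
            refine ⟨_, hw.shift_mem _ (hbd x hx).1 k hk, hkc, ?_⟩
            rw [hb k hk]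
            simp)
        obtain ⟨x', hx', hxc'⟩ := hG.mem_closure.1 hy (max c (g + e))
        have h1 := hc _ (hbd x' hx').1 (gamNear_init (gamNear_mono (le_max_left _ _) hxc'))
        have h2 := toOm_le_toOm_coe.1 ((hbd x' hx').2.2.trans h1.le)
        have h3 := (gamNear_mono (le_max_right c (g + e)) hxc' (Fin.last m)).2 hyl
        exact absurd h3 (not_lt.2 h2)
      have hqr : q ≤ r := by
        obtain ⟨b, hb⟩ := hq _ (hbd x₀ hx₀).1
        obtain ⟨b', hb'⟩ := hr _ (hbd x₀ hx₀).1
        rw [← sub_nonneg]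
        refine slope_nonneg he (b := b') (B := b) fun k hk => ?_
        have := hμν _ (hw.shift_mem _ (hbd x₀ hx₀).1 k hk)
        rw [hb k hk, hb' k hk, WithTop.coe_le_coe] at this
        rw [sub_smul, add_sub, le_sub_iff_add_le]
        exact this
      have hrnum : 0 < r.num.toNat := by
        have := Rat.num_pos.2 hrpos
        omega
      -- the direction follows the upper bound `ν`, with cleared denominators
      have hts : r * ((N (Fin.last m) * r.den : ℕ) : ℚ) =
          ((N (Fin.last m) * r.num.toNat : ℕ) : ℚ) := by
        have h1 : ((r.num.toNat : ℕ) : ℚ) = r.num := by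
          have : ((r.num.toNat : ℕ) : ℤ) = r.num := Int.toNat_of_nonneg (Rat.num_pos.2 hrpos).le
          exact_mod_cast this
        push_cast
        rw [h1, mul_left_comm, Rat.mul_den_eq_num]
      refine ⟨_, h.isDirection_snoc hw (t := N (Fin.last m) * r.den)
        (s := N (Fin.last m) * r.num.toNat) (Nat.mul_pos hNpos r.den_pos)
        (fun h => absurd hyl h) (fun _ => Nat.mul_pos hNpos hrnum)
        (fun x hx k hk => ⟨hlow _ _ ?_ x hx k hk, ?_⟩) fun _ => dvd_mul_right _ _⟩
      · rw [← hts]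
        exact mul_le_mul_of_nonneg_right hqr (Nat.cast_nonneg _)
      · obtain ⟨hxs, -, hxν⟩ := hbd x hx
        obtain ⟨b, hb⟩ := hr _ hxs
        obtain ⟨z, hz⟩ := hfin x hx
        have hb0 := hb 0 le_rfl
        rw [gamShift_zero] at hb0
        rw [hb0, hz, toOm_coe, WithTop.coe_le_coe] at hxν
        rw [hb _ (nsmul_nonneg hk _), hz, ← WithTop.coe_add, toOm_coe, WithTop.coe_le_coe,
          DivisibleHull.coe_add, DivisibleHull.coe_nsmul, DivisibleHull.coe_nsmul, smul_smul, hts]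
        exact add_le_add_left (by simpa using hxν) _

end Precells

/-! ### Division in the value group, and the valuation topology -/

section

variable {G : Type*} [AddCommGroup G] [LinearOrder G] [IsOrderedAddMonoid G]

/-- Euclidean division by a positive integer in a `ℤ`-group. -/
theorem IsZGroup.exists_eq_smul_add (hG : IsZGroup G) {e : G} (he : IsLeast {x : G | 0 < x} e)
    {n : ℕ} (hn : 1 ≤ n) (g : G) : ∃ r < n, ∃ b : G, g = r • e + n • b := by
  let φ : Fin n → G ⧸ (nsmulAddMonoidHom (α := G) n).range :=
    fun r => QuotientAddGroup.mk ((r : ℕ) • e)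
  have hcard := hG.card_quotient n hn
  have : Finite (G ⧸ (nsmulAddMonoidHom (α := G) n).range) :=
    Nat.finite_of_card_ne_zero (by omega)
  have hlt : ∀ r s : Fin n, r < s → φ r ≠ φ s := by
    intro r s hrs h
    obtain ⟨b, hb⟩ := QuotientAddGroup.eq.1 h
    have hb' : n • b = ((s : ℕ) - (r : ℕ)) • e := by
      rw [nsmulAddMonoidHom_apply] at hb
      rw [hb, neg_add_eq_sub, sub_eq_iff_eq_add, ← add_smul, Nat.sub_add_cancel hrs.le]
    have hpos : 0 < (s : ℕ) - (r : ℕ) := Nat.sub_pos_of_lt hrs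
    have hbpos : 0 < b := by
      by_contra! hle
      have h1 : 0 < n • b := hb' ▸ nsmul_pos he.1 hpos.ne'
      exact absurd h1 (not_lt.2 (nsmul_nonpos hle n))
    have h2 : n • e ≤ ((s : ℕ) - (r : ℕ)) • e := hb' ▸ nsmul_le_nsmul_right (he.2 hbpos) n
    have h3 : ((s : ℕ) - (r : ℕ)) • e < n • e :=
      nsmul_lt_nsmul_left he.1 (by have := s.2; omega)
    exact absurd h2 (not_le.2 h3)
  have hinj : Function.Injective φ := by
    intro r s h
    rcases lt_trichotomy r s with h' | h' | h'
    · exact absurd h (hlt r s h')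
    · exact h'
    · exact absurd h.symm (hlt s r h')
  have hsurj : Function.Surjective φ := by
    have := (Nat.bijective_iff_injective_and_card φ).2 ⟨hinj, by simp [hcard]⟩
    exact this.2
  obtain ⟨r, hr⟩ := hsurj (QuotientAddGroup.mk g)
  obtain ⟨b, hb⟩ := QuotientAddGroup.eq.1 hr
  refine ⟨r, r.2, b, ?_⟩
  rw [nsmulAddMonoidHom_apply] at hb
  rw [hb]
  abel

end

section

variable {K : Type*} [Field K] {G : Type*} [AddCommGroup G] [LinearOrder G]
  [IsOrderedAddMonoid G] {v : AddValuation K (WithTop G)}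

theorem mem_valRing {x : K} : x ∈ valRing v ↔ 0 ≤ v x := by
  rw [Valuation.mem_valuationSubring_iff]
  rfl

theorem exists_coe_eq {x : K} (hx : x ≠ 0) : ∃ g : G, v x = (g : WithTop G) := by
  have := (AddValuation.ne_top_iff v).2 hx
  exact (WithTop.ne_top_iff_exists.1 this).imp fun _ h => h.symm

theorem mem_maximalIdeal_iff_pos {r : valRing v} :
    r ∈ IsLocalRing.maximalIdeal (valRing v) ↔ 0 < v (r : K) := by
  rw [IsLocalRing.mem_maximalIdeal, mem_nonunits_iff, ← not_le, not_iff_not]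
  constructor
  · rintro ⟨u, rfl⟩
    have h1 : v ((u : valRing v) : K) + v (((u⁻¹ : (valRing v)ˣ) : valRing v) : K) = 0 := by
      rw [← AddValuation.map_mul, ← AddValuation.map_one v]
      exact congrArg (fun t : valRing v => v (t : K)) u.mul_inv
    rw [← h1]
    exact le_add_of_nonneg_right (mem_valRing.1 (SetLike.coe_mem _))
  · intro h
    have h0 : v (r : K) = 0 := le_antisymm h (mem_valRing.1 r.2)
    have hr : (r : K) ≠ 0 := by
      intro h1
      rw [h1, AddValuation.map_zero] at h0
      exact WithTop.top_ne_zero h0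
    have hinv : (r : K)⁻¹ ∈ valRing v := by
      have h1 : v (r : K) + v (r : K)⁻¹ = 0 := by
        rw [← AddValuation.map_mul, mul_inv_cancel₀ hr, AddValuation.map_one]
      rw [h0, zero_add] at h1
      exact mem_valRing.2 h1.ge
    refine IsUnit.of_mul_eq_one ⟨(r : K)⁻¹, hinv⟩ (Subtype.ext ?_)
    exact mul_inv_cancel₀ hr

/-- The valuation of a uniformizer is the smallest positive element of the value group. -/
theorem IsPAdicallyClosed.isLeast_uniformizer (hv : IsPAdicallyClosed v) {π : valRing v}
    (hπ : IsLocalRing.maximalIdeal (valRing v) = Ideal.span {π}) :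
    ∃ e : G, IsLeast {x : G | 0 < x} e ∧ v (π : K) = (e : WithTop G) := by
  have hdvd : ∀ g : G, 0 < g → v (π : K) ≤ (g : WithTop G) := by
    intro g hg
    obtain ⟨x, hx⟩ := hv.surjective (g : WithTop G)
    have hx0 : 0 < v x := by rw [hx]; exact_mod_cast hg
    have hmem : (⟨x, mem_valRing.2 hx0.le⟩ : valRing v) ∈ IsLocalRing.maximalIdeal (valRing v) :=
      mem_maximalIdeal_iff_pos.2 hx0
    rw [hπ, Ideal.mem_span_singleton] at hmem
    obtain ⟨r, hr⟩ := hmem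
    have hxr : x = π * r := congrArg Subtype.val hr
    rw [← hx, hxr, AddValuation.map_mul]
    exact le_add_of_nonneg_right (mem_valRing.1 r.2)
  obtain ⟨e, he⟩ := hv.zGroup.exists_least_pos
  have hpos : 0 < v (π : K) :=
    mem_maximalIdeal_iff_pos.1 (hπ ▸ Ideal.mem_span_singleton_self π)
  have hle := hdvd e he.1
  obtain ⟨g, hg⟩ := WithTop.ne_top_iff_exists.1 (hle.trans_lt (WithTop.coe_lt_top e)).ne
  rw [← hg] at hpos hle
  have h1 : g = e := le_antisymm (by exact_mod_cast hle) (he.2 (by exact_mod_cast hpos))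
  exact ⟨e, he, by rw [← hg, h1]⟩

theorem IsPAdicallyClosed.card_units_pos (hv : IsPAdicallyClosed v) {π : valRing v}
    (hπ : IsLocalRing.maximalIdeal (valRing v) = Ideal.span {π}) (M : ℕ) :
    0 < Nat.card (valRing v ⧸ Ideal.span {π ^ M})ˣ := by
  have h1 : Finite (valRing v ⧸ IsLocalRing.maximalIdeal (valRing v)) := hv.finite_residueField
  have h2 : (IsLocalRing.maximalIdeal (valRing v)).FG := ⟨{π}, by simp [hπ]⟩
  have := Ideal.finite_quotient_pow h2 M
  rw [hπ, Ideal.span_singleton_pow] at this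
  exact Nat.card_pos

theorem mem_nhds_val (hv : IsPAdicallyClosed v) {y : K} {U : Set K} :
    U ∈ @nhds _ (Valued.mk' (AddValuation.toValuation v)).toUniformSpace.toTopologicalSpace y ↔
      ∃ c : G, {x | (c : WithTop G) < v (x - y)} ⊆ U := by
  let V := Valued.mk' (AddValuation.toValuation v)
  rw [Valued.mem_nhds]
  constructor
  · rintro ⟨γ, hγ⟩
    have h0 : MonoidWithZeroHom.ValueGroup₀.embedding γ.1 ≠ (0 : Multiplicative (WithTop G)ᵒᵈ) := by
      intro h
      exact γ.ne_zero (MonoidWithZeroHom.ValueGroup₀.embedding_injective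
        (h.trans (map_zero _).symm))
    obtain ⟨c, hc⟩ := WithTop.ne_top_iff_exists.1 (show
      OrderDual.ofDual (Multiplicative.toAdd (MonoidWithZeroHom.ValueGroup₀.embedding γ.1)) ≠
        (⊤ : WithTop G) from h0)
    refine ⟨c, fun x hx => hγ ?_⟩
    rw [mem_ofPred_eq, Valuation.restrict_lt_iff_lt_embedding]
    rw [mem_ofPred_eq, hc] at hx
    exact hx
  · rintro ⟨c, hc⟩
    obtain ⟨x, hx⟩ := hv.surjective (c : WithTop G)
    have h0 : V.v.restrict x ≠ 0 := by
      rw [ne_eq, Valuation.restrict_eq_zero_iff]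
      intro h
      have : v x = ⊤ := h
      rw [hx] at this
      exact WithTop.coe_ne_top this
    refine ⟨Units.mk0 _ h0, fun z hz => hc ?_⟩
    rw [mem_ofPred_eq, Units.val_mk0, Valuation.restrict_lt_iff] at hz
    rw [mem_ofPred_eq, ← hx]
    exact hz

theorem mem_nhds_valPi (hv : IsPAdicallyClosed v) {m : ℕ} {y : Fin m → K} {U : Set (Fin m → K)} :
    U ∈ @nhds _ (valPiTop v m) y ↔ ∃ c : G, {x | ∀ i, (c : WithTop G) < v (x i - y i)} ⊆ U := by
  let _ := (Valued.mk' (AddValuation.toValuation v)).toUniformSpace.toTopologicalSpace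
  rw [nhds_pi]
  constructor
  · intro h
    obtain ⟨I, -, t, ht, hU⟩ := Filter.mem_pi.1 h
    choose c hc using fun i => (mem_nhds_val hv).1 (ht i)
    obtain ⟨M, hM⟩ := Finite.exists_le c
    exact ⟨M, fun x hx => hU fun i _ => hc i (lt_of_le_of_lt (by exact_mod_cast hM i) (hx i))⟩
  · rintro ⟨c, hc⟩
    have h : (univ : Set (Fin m)).pi (fun i => {z : K | (c : WithTop G) < v (z - y i)}) ∈
        Filter.pi fun i => nhds (y i) :=
      Filter.pi_mem_pi finite_univ fun i _ => (mem_nhds_val hv).2 ⟨c, Subset.rfl⟩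
    exact Filter.mem_of_superset h fun x hx => hc fun i => hx i (mem_univ i)

theorem mem_valClosure (hv : IsPAdicallyClosed v) {m : ℕ} {y : Fin m → K} {A : Set (Fin m → K)} :
    y ∈ valClosure v A ↔ ∀ c : G, ∃ x ∈ A, ∀ i, (c : WithTop G) < v (x i - y i) := by
  rw [valClosure, @mem_closure_iff_nhds _ (valPiTop v m)]
  constructor
  · intro h c
    obtain ⟨x, hx, hA⟩ := h _ ((mem_nhds_valPi hv).2 ⟨c, Subset.rfl⟩)
    exact ⟨x, hA, hx⟩
  · intro h U hU
    obtain ⟨c, hc⟩ := (mem_nhds_valPi hv).1 hU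
    obtain ⟨x, hA, hx⟩ := h c
    exact ⟨x, hc hx, hA⟩

end

/-! ### Definability -/

section FieldDefinable

variable {K : Type*} [Field K] {α β : Type*}

/-- A set of points of `K^α` is definable with parameters in the language of rings. -/
def FieldDefinable (s : Set (α → K)) : Prop :=
  letI := FirstOrder.Ring.compatibleRingOfRing K
  (Set.univ : Set K).Definable FirstOrder.Language.ring s

/-- A function on `K^α` is given by a polynomial. -/
def IsPolyFun (f : (α → K) → K) : Prop :=
  ∃ p : MvPolynomial α K, ∀ x, MvPolynomial.eval x p = f x

theorem isPolyFun_const (c : K) : IsPolyFun fun _ : α → K => c :=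
  ⟨MvPolynomial.C c, by simp⟩

theorem isPolyFun_apply (i : α) : IsPolyFun fun x : α → K => x i :=
  ⟨MvPolynomial.X i, by simp⟩

theorem IsPolyFun.add {f g : (α → K) → K} (hf : IsPolyFun f) (hg : IsPolyFun g) :
    IsPolyFun fun x => f x + g x := by
  obtain ⟨p, hp⟩ := hf
  obtain ⟨q, hq⟩ := hg
  exact ⟨p + q, fun x => by simp [hp, hq]⟩

theorem IsPolyFun.mul {f g : (α → K) → K} (hf : IsPolyFun f) (hg : IsPolyFun g) :
    IsPolyFun fun x => f x * g x := by
  obtain ⟨p, hp⟩ := hf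
  obtain ⟨q, hq⟩ := hg
  exact ⟨p * q, fun x => by simp [hp, hq]⟩

theorem IsPolyFun.pow {f : (α → K) → K} (hf : IsPolyFun f) (n : ℕ) :
    IsPolyFun fun x => f x ^ n := by
  obtain ⟨p, hp⟩ := hf
  exact ⟨p ^ n, fun x => by simp [hp]⟩

theorem IsPolyFun.prod {ι : Type*} (s : Finset ι) {f : ι → (α → K) → K}
    (hf : ∀ i, IsPolyFun (f i)) : IsPolyFun fun x => ∏ i ∈ s, f i x := by
  choose p hp using hf
  exact ⟨∏ i ∈ s, p i, fun x => by simp [hp]⟩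

theorem IsPolyFun.comp {f : (α → K) → K} (hf : IsPolyFun f) (σ : α → β) :
    IsPolyFun fun x : β → K => f (x ∘ σ) := by
  obtain ⟨p, hp⟩ := hf
  exact ⟨MvPolynomial.rename σ p, fun x => by rw [MvPolynomial.eval_rename, hp]⟩

theorem FieldDefinable.inter {s t : Set (α → K)} (hs : FieldDefinable s) (ht : FieldDefinable t) :
    FieldDefinable (s ∩ t) :=
  let _ := FirstOrder.Ring.compatibleRingOfRing K
  Set.Definable.inter hs ht

theorem FieldDefinable.union {s t : Set (α → K)} (hs : FieldDefinable s) (ht : FieldDefinable t) :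
    FieldDefinable (s ∪ t) :=
  let _ := FirstOrder.Ring.compatibleRingOfRing K
  Set.Definable.union hs ht

theorem FieldDefinable.compl {s : Set (α → K)} (hs : FieldDefinable s) : FieldDefinable sᶜ :=
  let _ := FirstOrder.Ring.compatibleRingOfRing K
  Set.Definable.compl hs

theorem FieldDefinable.and {p q : (α → K) → Prop} (hp : FieldDefinable {x | p x})
    (hq : FieldDefinable {x | q x}) : FieldDefinable {x | p x ∧ q x} :=
  hp.inter hq

theorem FieldDefinable.or {p q : (α → K) → Prop} (hp : FieldDefinable {x | p x})
    (hq : FieldDefinable {x | q x}) : FieldDefinable {x | p x ∨ q x} :=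
  hp.union hq

theorem FieldDefinable.not {p : (α → K) → Prop} (hp : FieldDefinable {x | p x}) :
    FieldDefinable {x | ¬ p x} :=
  hp.compl

theorem fieldDefinable_const (p : Prop) : FieldDefinable {_x : α → K | p} := by
  let _ := FirstOrder.Ring.compatibleRingOfRing K
  by_cases hp : p
  · simp only [hp]
    exact Set.definable_univ
  · simp only [hp]
    exact Set.definable_empty

theorem FieldDefinable.forall {ι : Type*} [Finite ι] {p : ι → (α → K) → Prop}
    (hp : ∀ i, FieldDefinable {x | p i x}) : FieldDefinable {x | ∀ i, p i x} := by
  let _ := FirstOrder.Ring.compatibleRingOfRing K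
  have := Set.definable_iInter_of_finite hp
  rwa [← ofPred_forall] at this

theorem FieldDefinable.exists {ι : Type*} [Finite ι] {p : ι → (α → K) → Prop}
    (hp : ∀ i, FieldDefinable {x | p i x}) : FieldDefinable {x | ∃ i, p i x} := by
  let _ := FirstOrder.Ring.compatibleRingOfRing K
  have := Set.definable_iUnion_of_finite hp
  rwa [← ofPred_exists] at this

theorem FieldDefinable.preimage_comp {s : Set (α → K)} (hs : FieldDefinable s) (σ : α → β) :
    FieldDefinable {x : β → K | x ∘ σ ∈ s} :=
  let _ := FirstOrder.Ring.compatibleRingOfRing K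
  Set.Definable.preimage_comp σ hs

/-- Existential quantification over one element of the field. -/
theorem FieldDefinable.exists_elem {p : (α → K) → K → Prop}
    (hp : FieldDefinable {z : α ⊕ Unit → K | p (z ∘ Sum.inl) (z (Sum.inr ()))}) :
    FieldDefinable {x | ∃ t, p x t} := by
  have : {x | ∃ t, p x t} = {x : α → K | ∃ u : Unit → K, Sum.elim x u ∈
      {z : α ⊕ Unit → K | p (z ∘ Sum.inl) (z (Sum.inr ()))}} := by
    ext x
    simp only [mem_ofPred_eq, Sum.elim_comp_inl, Sum.elim_inr]
    exact ⟨fun ⟨t, ht⟩ => ⟨fun _ => t, ht⟩, fun ⟨u, hu⟩ => ⟨u (), hu⟩⟩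
  let _ := FirstOrder.Ring.compatibleRingOfRing K
  rw [this]
  exact Set.Definable.exists_of_finite hp

theorem IsPolyFun.definable_eq {f g : (α → K) → K} (hf : IsPolyFun f) (hg : IsPolyFun g) :
    FieldDefinable {x | f x = g x} := by
  let _ := FirstOrder.Ring.compatibleRingOfRing K
  obtain ⟨p, hp⟩ := hf
  obtain ⟨q, hq⟩ := hg
  have h := (FirstOrder.Ring.mvPolynomial_zeroLocus_definable {p - q}).mono (subset_univ _)
  have h2 : {x | f x = g x} =
      MvPolynomial.zeroLocus K (Ideal.span ((({p - q} : Finset (MvPolynomial α K))) :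
        Set (MvPolynomial α K))) := by
    ext x
    rw [MvPolynomial.zeroLocus_span]
    simp [MvPolynomial.aeval_eq_eval, ← hp, ← hq, sub_eq_zero]
  rw [h2]
  exact h

end FieldDefinable

section Valued

variable {K : Type*} [Field K] {G : Type*} [AddCommGroup G] [LinearOrder G]
  [IsOrderedAddMonoid G] {v : AddValuation K (WithTop G)} {α : Type*}

/-- The valuation ring is defined by an existential formula: for an exponent `l ≥ 2` which is
invertible in the residue field, `x ∈ R` if and only if `1 + π x ^ l` is an `l`-th power. -/
theorem IsPAdicallyClosed.exists_pow_iff (hv : IsPAdicallyClosed v) {π : valRing v}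
    (hπ : IsLocalRing.maximalIdeal (valRing v) = Ideal.span {π}) :
    ∃ l : ℕ, ∀ x : K, x ∈ valRing v ↔ ∃ t : K, t ^ l = 1 + π * x ^ l := by
  obtain ⟨e, he, hπe⟩ := hv.isLeast_uniformizer hπ
  have hfin := hv.finite_residueField
  let k := IsLocalRing.ResidueField (valRing v)
  have hq : (Nat.card k : k) = 0 := by
    have := Fintype.ofFinite k
    rw [Nat.card_eq_fintype_card]
    exact Nat.cast_card_eq_zero k
  have hk : 2 ≤ Nat.card k := Finite.one_lt_card
  set l := Nat.card k + 1 with hl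
  refine ⟨l, fun x => ⟨fun hx => ?_, ?_⟩⟩
  · let y : valRing v := ⟨x, hx⟩
    have hmonic : (Polynomial.X ^ l - Polynomial.C (1 + π * y ^ l)).Monic :=
      Polynomial.monic_X_pow_sub_C _ (by omega)
    obtain ⟨a, ha, -⟩ := hv.henselian.is_henselian _ hmonic 1
      (by
        rw [hπ, Ideal.mem_span_singleton]
        simp) (by
        simp only [Polynomial.derivative_sub, Polynomial.derivative_X_pow, Polynomial.derivative_C,
          sub_zero, Polynomial.eval_mul, Polynomial.eval_pow, Polynomial.eval_X, one_pow, mul_one,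
          Polynomial.eval_C]
        rw [← not_not (a := IsUnit _), ← mem_nonunits_iff, ← IsLocalRing.mem_maximalIdeal,
          ← IsLocalRing.residue_eq_zero_iff, map_natCast, hl, Nat.cast_add, hq]
        simp)
    refine ⟨a, ?_⟩
    have h1 : a ^ l = 1 + π * y ^ l := by
      simpa [Polynomial.IsRoot, sub_eq_zero] using ha
    exact congrArg Subtype.val h1
  · rintro ⟨t, ht⟩
    by_contra hx
    rw [mem_valRing, not_le] at hx
    have hx0 : x ≠ 0 := by
      rintro rfl
      simp at hx
    obtain ⟨g, hg⟩ := exists_coe_eq (v := v) hx0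
    rw [hg] at hx
    have hg0 : g < 0 := by exact_mod_cast hx
    have hge : e ≤ -g := he.2 (neg_pos.2 hg0)
    have hneg : e + l • g < 0 := by
      have h1 : e + g ≤ 0 := by simpa using add_le_add_left hge g
      have h2 : (Nat.card k) • g < 0 := nsmul_neg hg0 (by omega)
      rw [hl, succ_nsmul, add_left_comm]
      exact add_neg_of_neg_of_nonpos h2 h1
    have h1 : v ((π : K) * x ^ l) = ((e + l • g : G) : WithTop G) := by
      rw [AddValuation.map_mul, AddValuation.map_pow, hπe, hg]
      rfl
    have h2 : v (1 + (π : K) * x ^ l) = ((e + l • g : G) : WithTop G) := by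
      rw [← h1]
      refine AddValuation.map_add_eq_of_lt_right _ ?_
      rw [h1, AddValuation.map_one]
      exact_mod_cast hneg
    have ht0 : t ≠ 0 := by
      rintro rfl
      rw [← ht, zero_pow (by omega), AddValuation.map_zero] at h2
      exact WithTop.coe_ne_top h2.symm
    obtain ⟨s, hs⟩ := exists_coe_eq (v := v) ht0
    rw [← ht, AddValuation.map_pow, hs] at h2
    have h3 : l • s = e + l • g := by exact_mod_cast h2
    have h4 : l • (s - g) = e := by rw [smul_sub, h3, add_sub_cancel_right]
    -- `e` would be divisible by `l` in the value group, against its minimality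
    have h5 : 0 < s - g := by
      by_contra! hle
      exact absurd he.1 (not_lt.2 (h4 ▸ nsmul_nonpos hle l))
    have h6 : l • e ≤ e := by
      conv_rhs => rw [← h4]
      exact nsmul_le_nsmul_right (he.2 h5) l
    have h7 : 1 • e < l • e := nsmul_lt_nsmul_left he.1 (by omega)
    rw [one_smul] at h7
    exact absurd h6 (not_le.2 h7)

theorem IsPolyFun.definable_mem_valRing (hv : IsPAdicallyClosed v) {π : valRing v}
    (hπ : IsLocalRing.maximalIdeal (valRing v) = Ideal.span {π}) {f : (α → K) → K}
    (hf : IsPolyFun f) : FieldDefinable {x | f x ∈ valRing v} := by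
  obtain ⟨l, hl⟩ := hv.exists_pow_iff hπ
  simp only [hl]
  exact .exists_elem (((isPolyFun_apply _).pow l).definable_eq
    ((isPolyFun_const 1).add ((isPolyFun_const _).mul ((hf.comp Sum.inl).pow l))))

theorem val_le_iff {x y : K} : v x ≤ v y ↔ ∃ t ∈ valRing v, y = t * x := by
  constructor
  · intro h
    by_cases hx : x = 0
    · refine ⟨0, zero_mem _, ?_⟩
      rw [hx, AddValuation.map_zero, top_le_iff, AddValuation.top_iff] at h
      simp [h]
    · refine ⟨y / x, ?_, by field_simp⟩
      rw [mem_valRing]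
      have h1 : v y = v (y / x) + v x := by
        rw [← AddValuation.map_mul, div_mul_cancel₀ _ hx]
      obtain ⟨g, hg⟩ := exists_coe_eq (v := v) hx
      rw [h1, hg] at h
      have h2 : 0 + (g : WithTop G) ≤ v (y / x) + g := by rwa [zero_add]
      exact WithTop.le_of_add_le_add_right WithTop.coe_ne_top h2
  · rintro ⟨t, ht, rfl⟩
    rw [AddValuation.map_mul]
    exact le_add_of_nonneg_left (mem_valRing.1 ht)

theorem IsPolyFun.definable_val_le (hv : IsPAdicallyClosed v) {π : valRing v}
    (hπ : IsLocalRing.maximalIdeal (valRing v) = Ideal.span {π}) {f g : (α → K) → K}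
    (hf : IsPolyFun f) (hg : IsPolyFun g) : FieldDefinable {x | v (f x) ≤ v (g x)} := by
  simp only [val_le_iff]
  exact .exists_elem (((isPolyFun_apply _).definable_mem_valRing hv hπ).and
    ((hg.comp Sum.inl).definable_eq ((isPolyFun_apply _).mul (hf.comp Sum.inl))))

theorem IsPolyFun.definable_val_eq (hv : IsPAdicallyClosed v) {π : valRing v}
    (hπ : IsLocalRing.maximalIdeal (valRing v) = Ideal.span {π}) {f g : (α → K) → K}
    (hf : IsPolyFun f) (hg : IsPolyFun g) : FieldDefinable {x | v (f x) = v (g x)} := by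
  simp only [le_antisymm_iff]
  exact (hf.definable_val_le hv hπ hg).and (hg.definable_val_le hv hπ hf)

/-- The exponents `l ∈ ℤ` of the uniformizer in the definition of `Q_{1,M}` may be restricted to
finitely many values, since `c`-th powers of `π` can be absorbed in the factor `y ^ c`. -/
theorem mem_Q1_iff (hv : IsPAdicallyClosed v) {π : valRing v}
    (hπ : IsLocalRing.maximalIdeal (valRing v) = Ideal.span {π}) {M : ℕ} {x : K} :
    x ∈ Q1 v π M ↔ ∃ s : Fin (Nat.card (valRing v ⧸ Ideal.span {π ^ M})ˣ), ∃ y r : K,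
      r ∈ valRing v ∧ y ≠ 0 ∧
      x = (π : K) ^ (s : ℕ) * y ^ Nat.card (valRing v ⧸ Ideal.span {π ^ M})ˣ *
        (1 + (π : K) ^ M * r) := by
  have hc := hv.card_units_pos hπ M
  set c := Nat.card (valRing v ⧸ Ideal.span {π ^ M})ˣ
  obtain ⟨e, he, hπe⟩ := hv.isLeast_uniformizer hπ
  have hπ0 : (π : K) ≠ 0 := by
    rw [← AddValuation.ne_top_iff v, hπe]
    exact WithTop.coe_ne_top
  constructor
  · rintro ⟨l, y, r, hy, rfl⟩
    have hc' : (c : ℤ) ≠ 0 := by exact_mod_cast hc.ne'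
    have h0 := Int.emod_nonneg l hc'
    have h1 := Int.emod_lt_of_pos l (by exact_mod_cast hc : (0 : ℤ) < c)
    refine ⟨⟨(l % c).toNat, by omega⟩, (π : K) ^ (l / c) * y, r, r.2,
      mul_ne_zero (zpow_ne_zero _ hπ0) hy, ?_⟩
    have h2 : (π : K) ^ l = (π : K) ^ (l % c).toNat * ((π : K) ^ (l / c)) ^ c := by
      rw [← zpow_natCast, ← zpow_natCast, ← zpow_mul, ← zpow_add₀ hπ0, Int.toNat_of_nonneg h0,
        mul_comm (l / c), Int.emod_add_mul_ediv]
    rw [h2, mul_pow]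
    ring
  · rintro ⟨s, y, r, hr, hy, rfl⟩
    exact ⟨s, y, ⟨r, hr⟩, hy, by simp [c]⟩

theorem fieldDefinable_DRm (hv : IsPAdicallyClosed v) {π : valRing v}
    (hπ : IsLocalRing.maximalIdeal (valRing v) = Ideal.span {π}) (M m : ℕ) :
    FieldDefinable (DRm v π M m) := by
  refine FieldDefinable.forall fun i => ?_
  have h : ∀ x : Fin m → K, x i ∈ DR v π M ↔ (x i = 0 ∨ x i ∈ Q1 v π M) ∧ x i ∈ valRing v :=
    fun x => Iff.rfl
  simp only [h, mem_Q1_iff hv hπ]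
  refine .and (.or ((isPolyFun_apply i).definable_eq (isPolyFun_const 0))
    (.exists fun s => .exists_elem (.exists_elem (.and ?_ (.and (.not ?_) ?_)))))
    ((isPolyFun_apply i).definable_mem_valRing hv hπ)
  · exact (isPolyFun_apply _).definable_mem_valRing hv hπ
  · exact (isPolyFun_apply (Sum.inl (Sum.inr ()))).definable_eq (isPolyFun_const 0)
  · exact (isPolyFun_apply (Sum.inl (Sum.inl i))).definable_eq
      (((isPolyFun_const _).mul ((isPolyFun_apply (Sum.inl (Sum.inr ()))).pow _)).mul
        ((isPolyFun_const 1).add ((isPolyFun_const _).mul (isPolyFun_apply (Sum.inr ())))))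

end Valued

section PrecellDefinable

variable {K : Type*} [Field K] {G : Type*} [AddCommGroup G] [LinearOrder G]
  [IsOrderedAddMonoid G] {v : AddValuation K (WithTop G)} {m : ℕ}

omit [LinearOrder G] [IsOrderedAddMonoid G] in
/-- Clearing denominators in an affine form over the divisible hull. -/
theorem exists_clear_denominators (α₀ : DivisibleHull G) (α : Fin m → ℚ) :
    ∃ (d : ℕ) (z : G) (p q : Fin m → ℕ), 0 < d ∧ ∀ a : Fin m → G,
      (d : ℚ) • (α₀ + ∑ i, α i • (DivisibleHull.coe (a i) : DivisibleHull G)) +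
        DivisibleHull.coe (∑ i, q i • a i) = DivisibleHull.coe (z + ∑ i, p i • a i) := by
  classical
  obtain ⟨z, s, rfl⟩ : ∃ (z : G) (s : ℕ+), α₀ = DivisibleHull.mk z s := by
    induction α₀ with
    | mk z s => exact ⟨z, s, rfl⟩
  set D : ℕ := ∏ i, (α i).den with hD
  have hint : ∀ i, ∃ n : ℤ, ((s * D : ℕ) : ℚ) * α i = n := by
    intro i
    obtain ⟨k, hk⟩ : (α i).den ∣ D := Finset.dvd_prod_of_mem _ (Finset.mem_univ i)
    refine ⟨s * k * (α i).num, ?_⟩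
    rw [hk]
    push_cast
    rw [← Rat.mul_den_eq_num (α i)]
    ring
  choose n hn using hint
  have hpq : ∀ i, ((s * D : ℕ) : ℚ) * α i + ((-n i).toNat : ℕ) = ((n i).toNat : ℕ) := by
    intro i
    rw [hn]
    have : (n i : ℤ) + ((-n i).toNat : ℕ) = ((n i).toNat : ℕ) := by omega
    exact_mod_cast this
  refine ⟨s * D, D • z, fun i => (n i).toNat, fun i => (-n i).toNat,
    Nat.mul_pos s.pos (Finset.prod_pos fun i _ => (α i).den_pos), fun a => ?_⟩
  have hsum : ∀ r : Fin m → ℕ, (DivisibleHull.coe (∑ i, r i • a i) : DivisibleHull G) =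
      ∑ i, (r i : ℚ) • DivisibleHull.coe (a i) := by
    intro r
    have := map_sum (DivisibleHull.coeAddMonoidHom G) (fun i => r i • a i) Finset.univ
    simp only [DivisibleHull.coeAddMonoidHom_apply] at this
    rw [this]
    exact Finset.sum_congr rfl fun i _ => DivisibleHull.coe_nsmul _ _
  have hz : ((s * D : ℕ) : ℚ) • (DivisibleHull.mk z s : DivisibleHull G) =
      DivisibleHull.coe (D • z) := by
    rw [Nat.cast_smul_eq_nsmul, DivisibleHull.nsmul_mk, DivisibleHull.mk_eq_mk]
    exact ⟨1, by simp [mul_smul]⟩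
  rw [DivisibleHull.coe_add, hsum, hsum, smul_add, hz, add_assoc, Finset.smul_sum,
    ← Finset.sum_add_distrib]
  refine congrArg _ (Finset.sum_congr rfl fun i _ => ?_)
  rw [smul_smul, ← add_smul, hpq]

theorem val_prod_pow {x : Fin m → K} {I : Set (Fin m)} [DecidablePred (· ∈ I)]
    (hx : gamSupp (vmap v x) = I) (p : Fin m → ℕ) :
    v (∏ i, if i ∈ I then x i ^ p i else 1) =
      ((∑ i, p i • (v (x i)).untopD 0 : G) : WithTop G) := by
  have h : ∀ s : Finset (Fin m), v (∏ i ∈ s, if i ∈ I then x i ^ p i else 1) =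
      ((∑ i ∈ s, p i • (v (x i)).untopD 0 : G) : WithTop G) := by
    classical
    intro s
    induction s using Finset.induction_on with
    | empty => simp
    | insert i s hi ih =>
      rw [Finset.prod_insert hi, Finset.sum_insert hi, AddValuation.map_mul, ih, WithTop.coe_add]
      congr 1
      have hiI : i ∈ I ↔ v (x i) ≠ ⊤ := by rw [← hx]; rfl
      by_cases h : v (x i) = ⊤
      · rw [if_neg (by simp [hiI, h])]
        simp [h]
      · obtain ⟨g, hg⟩ := WithTop.ne_top_iff_exists.1 h
        rw [if_pos (hiI.2 h), AddValuation.map_pow, ← hg]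
        rfl
  exact h Finset.univ

/-- Comparison of an affine form in the valuations of the first coordinates with the valuation of
the last coordinate, as a comparison of the valuations of two monomials. -/
theorem exists_polyFun_of_affine (hsurj : Function.Surjective v) (I : Set (Fin m))
    (α₀ : DivisibleHull G) (α : Fin m → ℚ) :
    ∃ f g : (Fin (m + 1) → K) → K, IsPolyFun f ∧ IsPolyFun g ∧ ∀ x : Fin (m + 1) → K,
      gamSupp (vmap v fun i : Fin m => x i.castSucc) = I →
      ((((α₀ + ∑ i, α i • (DivisibleHull.coe ((v (x (Fin.castSucc i))).untopD 0) :
          DivisibleHull G) : DivisibleHull G) : WithTop (DivisibleHull G)) ≤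
            toOm (v (x (Fin.last m))) ↔ v (f x) ≤ v (g x)) ∧
        (toOm (v (x (Fin.last m))) ≤ ((α₀ + ∑ i, α i •
          (DivisibleHull.coe ((v (x (Fin.castSucc i))).untopD 0) : DivisibleHull G) :
            DivisibleHull G) : WithTop (DivisibleHull G)) ↔ v (g x) ≤ v (f x))) := by
  classical
  obtain ⟨d, z, p, q, hd, h⟩ := exists_clear_denominators α₀ α
  obtain ⟨c, hc⟩ := hsurj (z : WithTop G)
  refine ⟨fun x => c * ∏ i, if i ∈ I then x (Fin.castSucc i) ^ p i else 1,
    fun x => x (Fin.last m) ^ d * ∏ i, if i ∈ I then x (Fin.castSucc i) ^ q i else 1,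
    (isPolyFun_const c).mul (IsPolyFun.prod _ fun i => ?_),
    ((isPolyFun_apply _).pow d).mul (IsPolyFun.prod _ fun i => ?_), fun x hx => ?_⟩
  · by_cases hi : i ∈ I
    · simpa only [hi, if_true] using (isPolyFun_apply i.castSucc).pow (p i)
    · simpa only [hi, if_false] using isPolyFun_const 1
  · by_cases hi : i ∈ I
    · simpa only [hi, if_true] using (isPolyFun_apply i.castSucc).pow (q i)
    · simpa only [hi, if_false] using isPolyFun_const 1
  have h' := h fun i => (v (x i.castSucc)).untopD 0
  set L := α₀ + ∑ i, α i • (DivisibleHull.coe ((v (x (Fin.castSucc i))).untopD 0) :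
          DivisibleHull G) with hL
  rw [AddValuation.map_mul, AddValuation.map_mul, hc, val_prod_pow hx p, val_prod_pow hx q,
    AddValuation.map_pow, ← WithTop.coe_add]
  set P := z + ∑ i, p i • (v (x (Fin.castSucc i))).untopD 0
  set Q := ∑ i, q i • (v (x (Fin.castSucc i))).untopD 0
  have hd' : (0 : ℚ) < d := by exact_mod_cast hd
  induction v (x (Fin.last m)) using WithTop.recTopCoe with
  | top =>
    have : d • (⊤ : WithTop G) = ⊤ := by
      obtain ⟨d, rfl⟩ := Nat.exists_eq_succ_of_ne_zero hd.ne'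
      rw [succ_nsmul, WithTop.add_top]
    simp [this, toOm]
  | coe b =>
    have hdb : d • (b : WithTop G) + (Q : WithTop G) = ((d • b + Q : G) : WithTop G) := rfl
    rw [hdb, toOm_coe, WithTop.coe_le_coe, WithTop.coe_le_coe, WithTop.coe_le_coe,
      WithTop.coe_le_coe, ← DivisibleHull.coe_le_coe (a := P),
      ← DivisibleHull.coe_le_coe (b := P), ← h', DivisibleHull.coe_add, DivisibleHull.coe_nsmul, add_le_add_iff_right,
      add_le_add_iff_right]
    exact ⟨(smul_le_smul_iff_of_pos_left hd').symm, (smul_le_smul_iff_of_pos_left hd').symm⟩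

theorem definable_gamModEq (hv : IsPAdicallyClosed v) {π : valRing v}
    (hπ : IsLocalRing.maximalIdeal (valRing v) = Ideal.span {π}) (i : Fin m) (ρ n : ℕ) :
    FieldDefinable {x : Fin m → K | GamModEq (v (x i)) ρ n} := by
  obtain ⟨e, he, hπe⟩ := hv.isLeast_uniformizer hπ
  have h : ∀ y : K, GamModEq (v y) ρ n ↔
      y = 0 ∨ ∃ t : K, t ≠ 0 ∧ v y = v ((π : K) ^ ρ * t ^ n) := by
    intro y
    by_cases hy : y = 0
    · simp [hy, GamModEq]
    obtain ⟨g, hg⟩ := exists_coe_eq (v := v) hy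
    have hval : ∀ (t : K) (b : G), v t = (b : WithTop G) →
        v ((π : K) ^ ρ * t ^ n) = ((ρ • e + n • b : G) : WithTop G) := by
      intro t b hb
      rw [AddValuation.map_mul, AddValuation.map_pow, AddValuation.map_pow, hπe, hb]
      rfl
    constructor
    · intro h
      obtain ⟨e', b, he', hgb⟩ := h g hg
      obtain ⟨t, ht⟩ := hv.surjective (b : WithTop G)
      refine Or.inr ⟨t, ?_, ?_⟩
      · rw [← AddValuation.ne_top_iff v, ht]
        exact WithTop.coe_ne_top
      · rw [hval t b ht, hg, hgb, he'.unique he]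
    · rintro (h | ⟨t, ht, hyt⟩)
      · exact absurd h hy
      · intro g' hg'
        obtain ⟨b, hb⟩ := exists_coe_eq (v := v) ht
        refine ⟨e, b, he, ?_⟩
        rw [hval t b hb, hg'] at hyt
        exact_mod_cast hyt
  simp only [h]
  exact .or ((isPolyFun_apply i).definable_eq (isPolyFun_const 0)) (.exists_elem (.and
    (.not ((isPolyFun_apply _).definable_eq (isPolyFun_const 0)))
    ((isPolyFun_apply (Sum.inl i)).definable_val_eq hv hπ
      ((isPolyFun_const _).mul ((isPolyFun_apply _).pow n)))))

/-- The inverse image of a precell by the valuation is definable. -/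
theorem IsLCPrecell.fieldDefinable (hv : IsPAdicallyClosed v) {π : valRing v}
    (hπ : IsLocalRing.maximalIdeal (valRing v) = Ideal.span {π}) : ∀ {m : ℕ} {N : Fin m → ℕ}
    {P : Set (Fin m → Gam G)} (_ : IsLCPrecell m N P),
    FieldDefinable {x : Fin m → K | vmap v x ∈ P} := by
  intro m
  induction m with
  | zero =>
    intro N P hP
    rw [show P = univ from hP]
    exact fieldDefinable_const True
  | succ m ih =>
    rintro N P ⟨hsoc, I, μ, ν, ρ, h⟩
    have hsupp : ∀ x : Fin (m + 1) → K, gamSupp (vmap v x) = I ↔ ∀ i, (x i = 0 ↔ i ∉ I) := by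
      intro x
      rw [Set.ext_iff]
      refine forall_congr' fun i => ?_
      rw [← AddValuation.top_iff v]
      have : i ∈ gamSupp (vmap v x) ↔ ¬ v (x i) = ⊤ := Iff.rfl
      rw [this]
      tauto
    have hS := gamSupp_socle (P := P) fun a ha => ((h.mem_iff a).1 ha).1
    -- the two bounds are definable over the points of the socle
    have hlow : ∃ D : Set (Fin (m + 1) → K), FieldDefinable D ∧ ∀ x,
        (fun i : Fin m => vmap v x i.castSucc) ∈ socle P →
          (μ (fun i : Fin m => vmap v x i.castSucc) ≤ toOm (vmap v x (Fin.last m)) ↔ x ∈ D) := by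
      rcases h.affine_left with hμ | ⟨α₀, α, hμ⟩
      · refine ⟨{x | x (Fin.last m) = 0}, (isPolyFun_apply _).definable_eq (isPolyFun_const 0),
          fun x hx => ?_⟩
        rw [hμ _ hx, top_le_iff, mem_ofPred_eq, ← AddValuation.top_iff v, vmap]
        induction v (x (Fin.last m)) using WithTop.recTopCoe with
        | top => simp [toOm]
        | coe b => simp [toOm_coe]
      · obtain ⟨f, g, hf, hg, hfg⟩ := exists_polyFun_of_affine hv.surjective
          (Fin.castSucc ⁻¹' I) α₀ α
        refine ⟨_, hf.definable_val_le hv hπ hg, fun x hx => ?_⟩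
        rw [hμ _ hx]
        exact (hfg x (hS _ hx)).1
    have hupp : ∃ D : Set (Fin (m + 1) → K), FieldDefinable D ∧ ∀ x,
        (fun i : Fin m => vmap v x i.castSucc) ∈ socle P →
          (toOm (vmap v x (Fin.last m)) ≤ ν (fun i : Fin m => vmap v x i.castSucc) ↔ x ∈ D) := by
      rcases h.affine_right with hν | ⟨α₀, α, hν⟩
      · refine ⟨univ, fieldDefinable_const True, fun x hx => ?_⟩
        rw [hν _ hx]
        simp
      · obtain ⟨f, g, hf, hg, hfg⟩ := exists_polyFun_of_affine hv.surjective
          (Fin.castSucc ⁻¹' I) α₀ α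
        refine ⟨_, hg.definable_val_le hv hπ hf, fun x hx => ?_⟩
        rw [hν _ hx]
        exact (hfg x (hS _ hx)).2
    obtain ⟨D₁, hD₁, h₁⟩ := hlow
    obtain ⟨D₂, hD₂, h₂⟩ := hupp
    have key : {x : Fin (m + 1) → K | vmap v x ∈ P} =
        {x | (∀ i, (x i = 0 ↔ i ∉ I)) ∧ (fun i : Fin m => vmap v x i.castSucc) ∈ socle P ∧
          x ∈ D₁ ∧ x ∈ D₂ ∧ GamModEq (v (x (Fin.last m))) ρ (N (Fin.last m))} := by
      ext x
      rw [mem_ofPred_eq, mem_ofPred_eq, h.mem_iff, hsupp]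
      refine and_congr_right fun _ => and_congr_right fun hx => ?_
      rw [h₁ x hx, h₂ x hx]
      rfl
    rw [key]
    refine .and (.forall fun i => ?_) (.and ((ih hsoc).preimage_comp Fin.castSucc)
      (.and hD₁ (.and hD₂ (definable_gamModEq hv hπ _ _ _))))
    have h0 := (isPolyFun_apply (K := K) i).definable_eq (isPolyFun_const 0)
    by_cases hi : i ∈ I
    · simpa [hi] using h0.not
    · simpa [hi] using h0

theorem IsPolytope.fieldDefinable (hv : IsPAdicallyClosed v) {π : valRing v}
    (hπ : IsLocalRing.maximalIdeal (valRing v) = Ideal.span {π}) {M : ℕ} {N : Fin m → ℕ}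
    {S : Set (Fin m → K)} (hS : IsPolytope v π M N S) : FieldDefinable S := by
  rw [hS.2]
  exact (hS.1.fieldDefinable hv hπ).inter (fieldDefinable_DRm hv hπ M m)

end PrecellDefinable

/-! ### Complexes of monotopes and their boundary -/

section Complex

variable {K : Type*} [Field K] {G : Type*} [AddCommGroup G] [LinearOrder G]
  [IsOrderedAddMonoid G] {v : AddValuation K (WithTop G)} {m : ℕ}

theorem IsZGroup.mem_of_mem_gamClosure (hG : IsZGroup G) {P : Set (Fin m → Gam G)}
    {y : Fin m → Gam G} (hy : y ∈ gamClosure P) (h : ∀ x ∈ P, gamSupp x = gamSupp y) : y ∈ P := by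
  obtain ⟨x, hx, hxy⟩ := hG.mem_closure.1 hy 0
  suffices x = y by rwa [← this]
  funext i
  by_cases hi : y i = ⊤
  · rw [hi]
    by_contra hne
    have : i ∈ gamSupp y := by rw [← h x hx]; exact hne
    exact this hi
  · exact (hxy i).1 hi

theorem IsZGroup.gamSupp_subset (hG : IsZGroup G) {P : Set (Fin m → Gam G)} {J : Set (Fin m)}
    {y : Fin m → Gam G} (hy : y ∈ gamClosure P) (h : ∀ x ∈ P, gamSupp x = J) : gamSupp y ⊆ J := by
  obtain ⟨x, hx, hxy⟩ := hG.mem_closure.1 hy 0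
  intro i hi
  rw [← h x hx]
  have : x i = y i := (hxy i).1 hi
  rwa [gamSupp, mem_ofPred_eq, this]

theorem IsZGroup.nonneg_of_mem_gamClosure (hG : IsZGroup G) {P : Set (Fin m → Gam G)}
    (h : ∀ x ∈ P, ∀ i, 0 ≤ x i) {y : Fin m → Gam G} (hy : y ∈ gamClosure P) (i : Fin m) :
    0 ≤ y i := by
  by_cases hi : y i = ⊤
  · rw [hi]
    exact le_top
  · obtain ⟨x, hx, hxy⟩ := hG.mem_closure.1 hy 0
    rw [← (hxy i).1 hi]
    exact h x hx i

/-- Every non-negative value is the valuation of a point of `D^M R`: if `g = r + c b` with `c` the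
order of `(R/π^M R)^×`, then `π ^ r y ^ c` is in `Q_{1,M}` for every `y` of valuation `b`. -/
theorem exists_mem_DR (hv : IsPAdicallyClosed v) {π : valRing v}
    (hπ : IsLocalRing.maximalIdeal (valRing v) = Ideal.span {π}) (M : ℕ) {a : Gam G}
    (ha : 0 ≤ a) : ∃ x ∈ DR v π M, v x = a := by
  by_cases hat : a = ⊤
  · exact ⟨0, ⟨Or.inl rfl, zero_mem (valRing v)⟩, by rw [AddValuation.map_zero, hat]⟩
  obtain ⟨g, rfl⟩ := WithTop.ne_top_iff_exists.1 hat
  obtain ⟨e, he, hπe⟩ := hv.isLeast_uniformizer hπ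
  obtain ⟨r, -, b, hb⟩ := hv.zGroup.exists_eq_smul_add he (hv.card_units_pos hπ M) g
  obtain ⟨y, hy⟩ := hv.surjective (b : WithTop G)
  have hy0 : y ≠ 0 := by
    rw [← AddValuation.ne_top_iff v, hy]
    exact WithTop.coe_ne_top
  have hval : v ((π : K) ^ r * y ^ Nat.card (valRing v ⧸ Ideal.span {π ^ M})ˣ) = g := by
    rw [AddValuation.map_mul, AddValuation.map_pow, AddValuation.map_pow, hπe, hy, hb]
    rfl
  refine ⟨_, ⟨Or.inr ⟨r, y, 0, hy0, ?_⟩, ?_⟩, hval⟩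
  · simp
  · rw [mem_ofPred_eq, mem_valRing, hval]
    exact ha

theorem mul_pow_mem_DR (hv : IsPAdicallyClosed v) {π : valRing v}
    (hπ : IsLocalRing.maximalIdeal (valRing v) = Ideal.span {π}) {M : ℕ} {x : K}
    (hx : x ∈ DR v π M) (j : ℕ) : x * (π : K) ^ j ∈ DR v π M := by
  refine ⟨?_, mul_mem hx.2 (pow_mem π.2 j)⟩
  obtain ⟨e, he, hπe⟩ := hv.isLeast_uniformizer hπ
  have hπ0 : (π : K) ≠ 0 := by
    rw [← AddValuation.ne_top_iff v, hπe]
    exact WithTop.coe_ne_top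
  rcases hx.1 with h | ⟨l, y, r, hy, h⟩
  · left
    rw [mem_singleton_iff] at h ⊢
    rw [h, zero_mul]
  · right
    refine ⟨l + j, y, r, hy, ?_⟩
    rw [h, zpow_add₀ hπ0, zpow_natCast]
    ring

theorem vmap_nonneg {π : valRing v} {M : ℕ} {x : Fin m → K} (hx : x ∈ DRm v π M m) (i : Fin m) :
    0 ≤ vmap v x i :=
  mem_valRing.1 (hx i).2

/-- The valuation is continuous from `K^m` to `Γ^m`. -/
theorem exists_vmap_mem_gamNear (v : AddValuation K (WithTop G)) (y : Fin m → K) (c : G) :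
    ∃ c' : G, ∀ x : Fin m → K, (∀ i, (c' : WithTop G) < v (x i - y i)) →
      vmap v x ∈ gamNear c (vmap v y) := by
  obtain ⟨B, hB⟩ := Finite.exists_le fun i => (v (y i)).untopD 0
  refine ⟨max c B, fun x hx i => ⟨fun hi => ?_, fun hi => ?_⟩⟩
  · refine AddValuation.map_eq_of_lt_sub _ (lt_of_le_of_lt ?_ (hx i))
    obtain ⟨g, hg⟩ := WithTop.ne_top_iff_exists.1 hi
    have h1 := hB i
    rw [show v (y i) = g from hg.symm] at h1 ⊢
    exact_mod_cast h1.trans (le_max_right _ _)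
  · have h0 : y i = 0 := (AddValuation.top_iff v).1 hi
    have h1 := hx i
    rw [h0, sub_zero] at h1
    exact lt_of_le_of_lt (by exact_mod_cast le_max_left c B) h1

/-- Approximations in `Γ^m` lift to approximations in `D^M R^m`. -/
theorem mem_valClosure_of_vmap_mem (hv : IsPAdicallyClosed v) {π : valRing v}
    (hπ : IsLocalRing.maximalIdeal (valRing v) = Ideal.span {π}) {M : ℕ} {P : Set (Fin m → Gam G)}
    (hP : ∀ x ∈ P, ∀ i, 0 ≤ x i) {y : Fin m → K} (hy : y ∈ DRm v π M m)
    (hyP : vmap v y ∈ gamClosure P) : y ∈ valClosure v (vmap v ⁻¹' P ∩ DRm v π M m) := by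
  rw [mem_valClosure hv]
  intro c
  obtain ⟨x, hx, hxc⟩ := hv.zGroup.mem_closure.1 hyP c
  have : ∀ i, ∃ a ∈ DR v π M, v a = x i ∧ (c : WithTop G) < v (a - y i) := by
    intro i
    by_cases hi : y i = 0
    · obtain ⟨a, ha, hax⟩ := exists_mem_DR hv hπ M (hP x hx i)
      refine ⟨a, ha, hax, ?_⟩
      rw [hi, sub_zero, hax]
      exact (hxc i).2 ((AddValuation.top_iff v).2 hi)
    · refine ⟨y i, hy i, ((hxc i).1 ((AddValuation.ne_top_iff v).2 hi)).symm, ?_⟩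
      rw [sub_self, AddValuation.map_zero]
      exact WithTop.coe_lt_top c
  choose a ha hax hac using this
  refine ⟨a, ⟨?_, ha⟩, hac⟩
  rw [mem_preimage, show vmap v a = x from funext hax]
  exact hx

/-- The supports of the points of `Ā \ A` which are in the closure of `S`; when `A` is the union of
a complex of monotopes containing `S`, these are the supports of the faces of `S` outside `A`. -/
def boundarySupports (v : AddValuation K (WithTop G)) (A S : Set (Fin m → K)) :
    Set (Set (Fin m)) :=
  {L | ∃ z ∈ valClosure v S \ A, gamSupp (vmap v z) = L}

section

variable {π : valRing v} {M : ℕ} {N : Fin m → ℕ} {C : Set (Set (Fin m → K))}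

theorem IsMonotopeComplex.subset_DRm (hC : IsMonotopeComplex v π M N C) {S : Set (Fin m → K)}
    (hS : S ∈ C) : S ⊆ DRm v π M m := by
  rw [(hC.monotope S hS).1.2]
  exact inter_subset_right

theorem IsMonotopeComplex.mem_iff (hC : IsMonotopeComplex v π M N C) {S : Set (Fin m → K)}
    (hS : S ∈ C) {x : Fin m → K} : x ∈ S ↔ vmap v x ∈ vmap v '' S ∧ x ∈ DRm v π M m := by
  conv_lhs => rw [(hC.monotope S hS).1.2]
  rfl

theorem IsMonotopeComplex.supp_eq (hC : IsMonotopeComplex v π M N C) {S : Set (Fin m → K)}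
    (hS : S ∈ C) {x y : Fin m → K} (hx : x ∈ S) (hy : y ∈ S) :
    gamSupp (vmap v x) = gamSupp (vmap v y) := by
  obtain ⟨I, hI⟩ := (hC.monotope S hS).1.1.exists_supp
  rw [hI _ ⟨x, hx, rfl⟩, hI _ ⟨y, hy, rfl⟩]

theorem IsMonotopeComplex.nonneg_of_mem_gamClosure (hv : IsPAdicallyClosed v)
    (hC : IsMonotopeComplex v π M N C) {S : Set (Fin m → K)} (hS : S ∈ C) {a : Fin m → Gam G}
    (ha : a ∈ gamClosure (vmap v '' S)) (i : Fin m) : 0 ≤ a i := by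
  refine hv.zGroup.nonneg_of_mem_gamClosure ?_ ha i
  rintro _ ⟨x, hx, rfl⟩
  exact vmap_nonneg (hC.subset_DRm hS hx)

/-- The closure of a monotope of a complex is the inverse image of the closure of its image. -/
theorem IsMonotopeComplex.mem_valClosure_iff (hC : IsMonotopeComplex v π M N C)
    {S : Set (Fin m → K)} (hS : S ∈ C) {z : Fin m → K} :
    z ∈ valClosure v S ↔ z ∈ DRm v π M m ∧ vmap v z ∈ gamClosure (vmap v '' S) := by
  have h := hC.inter_closure S hS S hS
  rw [inter_self] at h
  rw [h]
  constructor
  · rintro ⟨F, ⟨⟨J, -, rfl⟩, -⟩, hz⟩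
    exact ⟨hz.2, hz.1.1⟩
  · rintro ⟨hzD, hz⟩
    have hf : IsFace v π M (vmap v ⁻¹' gamFace (gamSupp (vmap v z)) (vmap v '' S) ∩ DRm v π M m)
        S := ⟨_, ⟨_, hz, rfl⟩, rfl⟩
    exact ⟨_, ⟨hf, hf⟩, ⟨hz, rfl⟩, hzD⟩

/-- A member `T` of a complex which meets the closure of a member `S` is a face of `S`. -/
theorem IsMonotopeComplex.mem_gamClosure_iff_mem (hv : IsPAdicallyClosed v)
    (hC : IsMonotopeComplex v π M N C) {S T : Set (Fin m → K)} (hS : S ∈ C) (hT : T ∈ C)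
    {y : Fin m → K} (hyT : y ∈ T) (hyS : y ∈ valClosure v S) {z : Fin m → K}
    (hz : z ∈ DRm v π M m) (hzy : gamSupp (vmap v z) = gamSupp (vmap v y)) :
    vmap v z ∈ gamClosure (vmap v '' S) ↔ z ∈ T := by
  have hmem : y ∈ valClosure v S ∩ valClosure v T :=
    ⟨hyS, @subset_closure _ (valPiTop v m) T y hyT⟩
  rw [hC.inter_closure S hS T hT] at hmem
  obtain ⟨F, ⟨⟨J, -, hF⟩, ⟨J', -, hF'⟩⟩, hyF⟩ := hmem
  have hJ : gamSupp (vmap v y) = J := by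
    rw [hF] at hyF
    exact hyF.1.2
  have hJ' : gamSupp (vmap v y) = J' := by
    rw [hF'] at hyF
    exact hyF.1.2
  constructor
  · intro h
    have hzF : z ∈ F := by
      rw [hF]
      exact ⟨⟨h, hzy.trans hJ⟩, hz⟩
    rw [hF'] at hzF
    rw [hC.mem_iff hT]
    refine ⟨hv.zGroup.mem_of_mem_gamClosure hzF.1.1 ?_, hz⟩
    rintro _ ⟨x, hx, rfl⟩
    rw [hzy, hC.supp_eq hT hx hyT]
  · intro h
    have hzF : z ∈ F := by
      rw [hF']
      exact ⟨⟨@subset_closure _ (gamPiTop G m) _ _ ⟨z, h, rfl⟩, hzy.trans hJ'⟩, hz⟩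
    rw [hF] at hzF
    exact hzF.1.1

/-- A face of a monotope which is not contained in the union of the complex is disjoint from it. -/
theorem IsMonotopeComplex.notMem_of_face (hv : IsPAdicallyClosed v)
    (hC : IsMonotopeComplex v π M N C) {S : Set (Fin m → K)} (hS : S ∈ C) {z z' : Fin m → K}
    (hz : z ∈ valClosure v S \ ⋃₀ C) (hz'D : z' ∈ DRm v π M m)
    (hz' : vmap v z' ∈ gamClosure (vmap v '' S)) (h : gamSupp (vmap v z') = gamSupp (vmap v z)) :
    z' ∉ ⋃₀ C := by
  rintro ⟨T, hT, hzT⟩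
  have hzS := (hC.mem_valClosure_iff hS).1 hz.1
  exact hz.2 ⟨T, hT, (hC.mem_gamClosure_iff_mem hv hS hT hzT
    ((hC.mem_valClosure_iff hS).2 ⟨hz'D, hz'⟩) hzS.1 h.symm).1 hzS.2⟩

/-- If a monotope `S` of the complex accumulates at a point `y` of the union `A`, with `y` in the
member `T`, then `S` and `T` have the same boundary faces, and these are proper faces of `T`. -/
theorem IsMonotopeComplex.boundarySupports_eq (hv : IsPAdicallyClosed v)
    (hπ : IsLocalRing.maximalIdeal (valRing v) = Ideal.span {π})
    (hC : IsMonotopeComplex v π M N C) (hopen : IsRelativelyOpen v (⋃₀ C))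
    {S T : Set (Fin m → K)} (hS : S ∈ C) (hT : T ∈ C)
    {y : Fin m → K} (hyT : y ∈ T) (hyS : y ∈ valClosure v S) :
    boundarySupports v (⋃₀ C) S = boundarySupports v (⋃₀ C) T ∧
      ∀ L ∈ boundarySupports v (⋃₀ C) S, L ⊂ gamSupp (vmap v y) := by
  have hG := hv.zGroup
  have hyD := hC.subset_DRm hT hyT
  have hyS' := ((hC.mem_valClosure_iff hS).1 hyS).2
  -- the face of `S` of the support of `y` is `T`
  have hfaceT : gamFace (gamSupp (vmap v y)) (vmap v '' S) ⊆ vmap v '' T := by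
    rintro a ⟨ha, hay⟩
    choose x hxD hx using fun i =>
      exists_mem_DR hv hπ M (hC.nonneg_of_mem_gamClosure hv hS ha i)
    have hxa : vmap v x = a := funext hx
    rw [← hxa] at ha hay ⊢
    exact ⟨x, (hC.mem_gamClosure_iff_mem hv hS hT hyT hyS hxD hay).1 ha, rfl⟩
  have hTS : T ⊆ valClosure v S := by
    intro z hz
    have hzD := hC.subset_DRm hT hz
    exact (hC.mem_valClosure_iff hS).2 ⟨hzD, (hC.mem_gamClosure_iff_mem hv hS hT hyT hyS hzD
      (hC.supp_eq hT hz hyT)).2 hz⟩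
  have key : ∀ z ∈ valClosure v S \ ⋃₀ C,
      vmap v z ∈ gamClosure (gamFace (gamSupp (vmap v y)) (vmap v '' S)) := by
    intro z hz
    have hzS := (hC.mem_valClosure_iff hS).1 hz.1
    rcases (hC.monotope S hS).2 (gamSupp (vmap v z)) (gamSupp (vmap v y)) ⟨_, hzS.2, rfl⟩
      ⟨_, hyS', rfl⟩ with h | h
    · exact h ⟨hzS.2, rfl⟩
    · -- otherwise `y` would be in the closure of the closed set `Ā \ A`
      exfalso
      have h1 := mem_valClosure_of_vmap_mem hv hπ
        (fun x hx => hC.nonneg_of_mem_gamClosure hv hS hx.1) hyD (h ⟨hyS', rfl⟩)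
      have h2 : vmap v ⁻¹' gamFace (gamSupp (vmap v z)) (vmap v '' S) ∩ DRm v π M m ⊆
          valClosure v (⋃₀ C) \ ⋃₀ C := by
        rintro z' ⟨⟨hz', hsupp⟩, hz'D⟩
        refine ⟨?_, hC.notMem_of_face hv hS hz hz'D hz' hsupp⟩
        exact @closure_mono _ (valPiTop v m) _ _ (subset_sUnion_of_mem hS) _
          ((hC.mem_valClosure_iff hS).2 ⟨hz'D, hz'⟩)
      have h3 := @closure_minimal _ (valPiTop v m) _ _ h2 hopen _ h1
      exact h3.2 ⟨T, hT, hyT⟩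
  have hclT : ∀ z ∈ valClosure v S \ ⋃₀ C, vmap v z ∈ gamClosure (vmap v '' T) :=
    fun z hz => @closure_mono _ (gamPiTop G m) _ _ hfaceT _ (key z hz)
  refine ⟨Subset.antisymm ?_ ?_, ?_⟩
  · rintro L ⟨z, hz, rfl⟩
    exact ⟨z, ⟨(hC.mem_valClosure_iff hT).2
      ⟨((hC.mem_valClosure_iff hS).1 hz.1).1, hclT z hz⟩, hz.2⟩, rfl⟩
  · rintro L ⟨z, hz, rfl⟩
    exact ⟨z, ⟨@closure_minimal _ (valPiTop v m) _ _ hTS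
      (@isClosed_closure _ (valPiTop v m) S) _ hz.1, hz.2⟩, rfl⟩
  · rintro L ⟨z, hz, rfl⟩
    refine (hG.gamSupp_subset (key z hz) fun x hx => hx.2).ssubset_of_ne fun heq => ?_
    have hzS := (hC.mem_valClosure_iff hS).1 hz.1
    exact hz.2 ⟨T, hT, (hC.mem_gamClosure_iff_mem hv hS hT hyT hyS hzS.1 heq).1 hzS.2⟩

/-- As the faces of a monotope form a chain, its largest boundary face has for support the union of
all the boundary supports, which is therefore a proper subset of the support of the points near
which the monotope accumulates in the union of the complex. -/
theorem IsMonotopeComplex.sUnion_boundarySupports_ssubset (hv : IsPAdicallyClosed v)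
    (hπ : IsLocalRing.maximalIdeal (valRing v) = Ideal.span {π})
    (hC : IsMonotopeComplex v π M N C) (hopen : IsRelativelyOpen v (⋃₀ C))
    {S : Set (Fin m → K)} (hS : S ∈ C) {y : Fin m → K} (hy : y ∈ S)
    (hne : (boundarySupports v (⋃₀ C) S).Nonempty) :
    ⋃₀ boundarySupports v (⋃₀ C) S ⊂ gamSupp (vmap v y) := by
  have hlt := (hC.boundarySupports_eq hv hπ hopen hS hS hy
    (@subset_closure _ (valPiTop v m) S y hy)).2
  obtain ⟨L, hL, hmax⟩ := (toFinite (boundarySupports v (⋃₀ C) S)).exists_maximal hne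
  have hle : ∀ L' ∈ boundarySupports v (⋃₀ C) S, L' ⊆ L := by
    intro L' hL'
    have hchain : L ⊆ L' ∨ L' ⊆ L := by
      obtain ⟨z, hz, hzL⟩ := hL
      obtain ⟨z', hz', hzL'⟩ := hL'
      have h1 : vmap v z ∈ gamFace L (vmap v '' S) :=
        ⟨((hC.mem_valClosure_iff hS).1 hz.1).2, hzL⟩
      have h2 : vmap v z' ∈ gamFace L' (vmap v '' S) :=
        ⟨((hC.mem_valClosure_iff hS).1 hz'.1).2, hzL'⟩
      rcases (hC.monotope S hS).2 L L' ⟨_, h1⟩ ⟨_, h2⟩ with h | h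
      · left
        rw [← hzL]
        exact hv.zGroup.gamSupp_subset (h h1) fun x hx => hx.2
      · right
        rw [← hzL']
        exact hv.zGroup.gamSupp_subset (h h2) fun x hx => hx.2
    exact hchain.elim (fun h => hmax hL' h) id
  exact (sUnion_subset hle).trans_ssubset (hlt L hL)

/-- The directions of the finitely many monotopes of a complex can be bounded uniformly, since they
only depend on the support of the limit point. -/
theorem IsMonotopeComplex.exists_bounded_directions (hv : IsPAdicallyClosed v)
    (hN : ∀ i, 1 ≤ N i) (hC : IsMonotopeComplex v π M N C) :
    ∃ B : ℕ, 1 ≤ B ∧ ∀ S ∈ C, ∀ y ∈ gamClosure (vmap v '' S), ∃ w,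
      IsDirection (vmap v '' S) y w ∧ ∀ i, w i ≤ B := by
  have : ∀ SL : C × Set (Fin m), ∃ b : ℕ, ∀ y ∈ gamClosure (vmap v '' SL.1.1),
      gamSupp y = SL.2 → ∃ w, IsDirection (vmap v '' SL.1.1) y w ∧ ∀ i, w i ≤ b := by
    rintro ⟨⟨S, hS⟩, L⟩
    by_cases h : ∃ y ∈ gamClosure (vmap v '' S), gamSupp y = L
    · obtain ⟨y, hy, hyL⟩ := h
      obtain ⟨w, hw⟩ := (hC.monotope S hS).1.1.exists_isDirection hv.zGroup hN hy
      obtain ⟨b, hb⟩ := Finite.exists_le w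
      refine ⟨b, fun y' _ hyL' => ⟨w, ⟨fun i hi => hw.eq_zero i ?_, fun i hi => hw.pos i ?_,
        hw.shift_mem⟩, hb⟩⟩
      · have : i ∈ gamSupp y := by rw [hyL, ← show gamSupp y' = L from hyL']; exact hi
        exact this
      · by_contra hne
        have : i ∈ gamSupp y' := by rw [show gamSupp y' = L from hyL', ← hyL]; exact hne
        exact this hi
    · exact ⟨0, fun y hy hyL => absurd ⟨y, hy, hyL⟩ h⟩
  choose b hb using this
  have := hC.finite.to_subtype
  obtain ⟨B, hB⟩ := Finite.exists_le b
  refine ⟨B + 1, by omega, fun S hS y hy => ?_⟩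
  obtain ⟨w, hw, hwb⟩ := hb (⟨S, hS⟩, gamSupp y) y hy rfl
  exact ⟨w, hw, fun i => ((hwb i).trans (hB _)).trans (Nat.le_succ B)⟩

end

end Complex

/-! ### Splitting along residue classes of the distance to the boundary -/

section Blocks

variable {G : Type*} [AddCommGroup G] [LinearOrder G] [IsOrderedAddMonoid G] {m : ℕ}

/-- `g` is in the block of index `k`: modulo `n * B`, it is congruent to an element of the interval
`[k * B, (k + 1) * B)`. Here `e` is the smallest positive element of `G`. -/
def InBlock (e : G) (B n k : ℕ) (g : G) : Prop :=
  ∃ b : G, (n * B) • b + (k * B) • e ≤ g ∧ g < (n * B) • b + ((k + 1) * B) • e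

theorem IsZGroup.exists_inBlock (hG : IsZGroup G) {e : G} (he : IsLeast {x : G | 0 < x} e)
    {B n : ℕ} (hB : 1 ≤ B) (hn : 1 ≤ n) (g : G) : ∃ k < n, InBlock e B n k g := by
  obtain ⟨r, hr, b, rfl⟩ := hG.exists_eq_smul_add he (Nat.mul_pos hn hB) g
  refine ⟨r / B, Nat.div_lt_of_lt_mul (by rwa [mul_comm]), b, ?_, ?_⟩
  · rw [add_comm]
    exact add_le_add_left (nsmul_le_nsmul_left he.1.le (Nat.div_mul_le_self r B)) _
  · rw [add_comm]
    refine add_lt_add_right (nsmul_lt_nsmul_left he.1 ?_) _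
    rw [mul_comm]
    exact Nat.lt_mul_div_succ r hB

theorem InBlock.eq {e : G} (he : IsLeast {x : G | 0 < x} e) {B n k k' : ℕ} {g : G}
    (hk : k < n) (hk' : k' < n) (h : InBlock e B n k g) (h' : InBlock e B n k' g) : k = k' := by
  have h0 : (0 : G) < e := he.1
  have hle : ∀ {k k' : ℕ} {b b' : G}, k < n → g < (n * B) • b + ((k + 1) * B) • e →
      (n * B) • b' + (k' * B) • e ≤ g → b' ≤ b := by
    intro k k' b b' hk h1 h2
    by_contra! hlt
    have h3 := nsmul_le_nsmul_right (IsLeast.add_le_of_lt he hlt) (n * B)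
    have h4 : ((k + 1) * B) • e ≤ (n * B) • e :=
      nsmul_le_nsmul_left h0.le (Nat.mul_le_mul_right B hk)
    have h5 : (0 : G) ≤ (k' * B) • e := nsmul_nonneg h0.le _
    rw [smul_add] at h3
    exact absurd h1 (not_lt.2 ((add_le_add_right h4 _).trans
      (h3.trans ((le_add_of_nonneg_right h5).trans h2))))
  have hlt : ∀ {k k' : ℕ} {b : G}, g < (n * B) • b + ((k + 1) * B) • e →
      (n * B) • b + (k' * B) • e ≤ g → k' ≤ k := by
    intro k k' b h1 h2
    have h3 := lt_of_add_lt_add_left (h2.trans_lt h1)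
    by_contra! hkk
    exact absurd h3 (not_lt.2 (nsmul_le_nsmul_left h0.le (Nat.mul_le_mul_right B hkk)))
  obtain ⟨b, hb1, hb2⟩ := h
  obtain ⟨b', hb1', hb2'⟩ := h'
  obtain rfl : b = b' := le_antisymm (hle hk' hb2' hb1) (hle hk hb2 hb1')
  exact le_antisymm (hlt hb2' hb1) (hlt hb2 hb1')

/-- A sequence which increases by steps between `1` and `B` meets all the blocks. -/
theorem IsZGroup.exists_inBlock_of_step (hG : IsZGroup G) {e : G}
    (he : IsLeast {x : G | 0 < x} e) {B n : ℕ} (hB : 1 ≤ B) (hn : 1 ≤ n) {h : ℕ → G}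
    (h1 : ∀ j, h j + e ≤ h (j + 1)) (h2 : ∀ j, h (j + 1) ≤ h j + B • e) (k : ℕ) :
    ∃ j, InBlock e B n k (h j) := by
  classical
  have h0 : (0 : G) < e := he.1
  obtain ⟨r, hr, b, hb⟩ := hG.exists_eq_smul_add he (Nat.mul_pos hn hB) (h 0)
  have hgrow : ∀ j : ℕ, h 0 + j • e ≤ h j := by
    intro j
    induction j with
    | zero => simp
    | succ j ih =>
      rw [succ_nsmul, ← add_assoc]
      exact (add_le_add_left ih e).trans (h1 j)
  -- `t` is the start of a block of index `k` above `h 0`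
  let t : G := (n * B) • (b + e) + (k * B) • e
  have ht0 : h 0 < t := by
    have h3 : r • e < (n * B) • e := nsmul_lt_nsmul_left h0 hr
    have h4 : (0 : G) ≤ (k * B) • e := nsmul_nonneg h0.le _
    calc h 0 = (n * B) • b + r • e := by rw [hb, add_comm]
      _ < (n * B) • b + (n * B) • e := add_lt_add_right h3 _
      _ ≤ t := by
        rw [← smul_add]
        exact le_add_of_nonneg_right h4
  have hex : ∃ j, t ≤ h j := by
    refine ⟨n * B + k * B, le_trans ?_ (hgrow _)⟩
    have h3 : (0 : G) ≤ r • e := nsmul_nonneg h0.le _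
    calc t = (n * B) • b + (n * B + k * B) • e := by rw [add_smul, ← add_assoc, ← smul_add]
      _ ≤ h 0 + (n * B + k * B) • e := by
        rw [hb]
        exact add_le_add_left (le_add_of_nonneg_left h3) _
  obtain ⟨j, hj⟩ : ∃ j, Nat.find hex = j + 1 := by
    refine Nat.exists_eq_succ_of_ne_zero fun hz => ?_
    have := Nat.find_spec hex
    rw [hz] at this
    exact absurd ht0 (not_lt.2 this)
  refine ⟨j + 1, b + e, hj ▸ Nat.find_spec hex, ?_⟩
  have hjt : h j < t := not_le.1 (Nat.find_min hex (by omega))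
  have h3 : t + B • e = (n * B) • (b + e) + ((k + 1) * B) • e := by
    rw [add_mul, one_mul, add_smul, ← add_assoc]
  rw [← h3]
  exact (h2 j).trans_lt (add_lt_add_left hjt _)

/-- The condition defining the piece of index `k`, for a point `a` of `Γ^m` which is the image of a
point of a monotope whose boundary supports are the elements of `L`. The minimum of the coordinates
of `a` outside `⋃₀ L` measures the distance of that point to the boundary; the piece is determined
by its block. When there is no boundary, everything is put in the piece of index `0`. -/
def HasLabel (e : G) (B n : ℕ) (L : Set (Set (Fin m))) (k : ℕ) (a : Fin m → Gam G) : Prop :=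
  (L = ∅ ∧ k = 0) ∨
    (L.Nonempty ∧ ∃ g : G, IsLeast (a '' (⋃₀ L)ᶜ) (g : WithTop G) ∧ InBlock e B n k g)

omit [AddCommGroup G] [IsOrderedAddMonoid G] in
theorem exists_isLeast_coe {J : Set (Fin m)} {a : Fin m → Gam G} (hJ : J ⊂ gamSupp a) :
    ∃ g : G, IsLeast (a '' Jᶜ) (g : WithTop G) := by
  obtain ⟨i₀, hi₀, hi₀J⟩ := exists_of_ssubset hJ
  obtain ⟨i, hi, hmin⟩ := exists_min_image Jᶜ a (toFinite _) ⟨i₀, hi₀J⟩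
  obtain ⟨g, hg⟩ := WithTop.ne_top_iff_exists.1
    ((hmin i₀ hi₀J).trans_lt (lt_top_iff_ne_top.2 hi₀)).ne
  refine ⟨g, ⟨i, hi, hg.symm⟩, ?_⟩
  rintro _ ⟨j, hj, rfl⟩
  rw [hg]
  exact hmin j hj

theorem IsZGroup.exists_hasLabel (hG : IsZGroup G) {e : G} (he : IsLeast {x : G | 0 < x} e)
    {B n : ℕ} (hB : 1 ≤ B) (hn : 1 ≤ n) {L : Set (Set (Fin m))} {a : Fin m → Gam G}
    (h : L.Nonempty → ⋃₀ L ⊂ gamSupp a) : ∃ k < n, HasLabel e B n L k a := by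
  rcases L.eq_empty_or_nonempty with hL | hL
  · exact ⟨0, hn, Or.inl ⟨hL, rfl⟩⟩
  · obtain ⟨g, hg⟩ := exists_isLeast_coe (h hL)
    obtain ⟨k, hk, hgk⟩ := hG.exists_inBlock he hB hn g
    exact ⟨k, hk, Or.inr ⟨hL, g, hg, hgk⟩⟩

theorem HasLabel.eq {e : G} (he : IsLeast {x : G | 0 < x} e) {B n k k' : ℕ}
    {L : Set (Set (Fin m))} {a : Fin m → Gam G} (hk : k < n) (hk' : k' < n)
    (h : HasLabel e B n L k a) (h' : HasLabel e B n L k' a) : k = k' := by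
  rcases h with ⟨hL, rfl⟩ | ⟨hL, g, hg, hgk⟩ <;> rcases h' with ⟨hL', rfl⟩ | ⟨hL', g', hg', hgk'⟩
  · rfl
  · exact absurd hL hL'.ne_empty
  · exact absurd hL' hL.ne_empty
  · obtain rfl : g = g' := by exact_mod_cast hg.unique hg'
    exact hgk.eq he hk hk' hgk'

omit [IsOrderedAddMonoid G] in
/-- Labels are locally constant: a point near `a` has the same minimum as `a`. -/
theorem HasLabel.of_near {e : G} {B n k : ℕ} {L : Set (Set (Fin m))} {a : Fin m → Gam G}
    (h : HasLabel e B n L k a) :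
    ∃ c : G, ∀ a' ∈ gamNear c a, HasLabel e B n L k a' := by
  obtain ⟨c, hc⟩ := Finite.exists_le fun i => (a i).untopD 0
  refine ⟨c, fun a' ha' => h.imp id ?_⟩
  rintro ⟨hL, g, ⟨⟨i, hi, hig⟩, hmin⟩, hgk⟩
  refine ⟨hL, g, ⟨⟨i, hi, ?_⟩, ?_⟩, hgk⟩
  · rw [(ha' i).1 (by rw [hig]; exact WithTop.coe_ne_top), hig]
  · rintro _ ⟨j, hj, rfl⟩
    by_cases hjt : a j = ⊤
    · refine le_trans ?_ ((ha' j).2 hjt).le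
      have := hc i
      rw [hig] at this
      exact_mod_cast this
    · rw [(ha' j).1 hjt]
      exact hmin ⟨j, hj, rfl⟩

end Blocks

section Field

variable {K : Type*} [Field K] {G : Type*} [AddCommGroup G] [LinearOrder G]
  [IsOrderedAddMonoid G] {v : AddValuation K (WithTop G)} {m : ℕ}

theorem definable_hasLabel (hv : IsPAdicallyClosed v) {π : valRing v}
    (hπ : IsLocalRing.maximalIdeal (valRing v) = Ideal.span {π}) {e : G}
    (hπe : v (π : K) = (e : WithTop G)) (B n : ℕ) (L : Set (Set (Fin m))) (k : ℕ) :
    FieldDefinable {x : Fin m → K | HasLabel e B n L k (vmap v x)} := by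
  have hval : ∀ (t : K) (b : G) (s : ℕ), v t = (b : WithTop G) →
      v (t ^ (n * B) * (π : K) ^ s) = (((n * B) • b + s • e : G) : WithTop G) := by
    intro t b s hb
    rw [AddValuation.map_mul, AddValuation.map_pow, AddValuation.map_pow, hπe, hb]
    rfl
  have hblock : ∀ (y : K) (g : G), v y = (g : WithTop G) → (InBlock e B n k g ↔
      ∃ t : K, t ≠ 0 ∧ v (t ^ (n * B) * (π : K) ^ (k * B)) ≤ v y ∧
        ¬ v (t ^ (n * B) * (π : K) ^ ((k + 1) * B)) ≤ v y) := by
    intro y g hy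
    constructor
    · rintro ⟨b, h1, h2⟩
      obtain ⟨t, ht⟩ := hv.surjective (b : WithTop G)
      refine ⟨t, ?_, ?_⟩
      · rw [← AddValuation.ne_top_iff v, ht]
        exact WithTop.coe_ne_top
      · rw [hval t b _ ht, hval t b _ ht, hy, WithTop.coe_le_coe, WithTop.coe_le_coe, not_le]
        exact ⟨h1, h2⟩
    · rintro ⟨t, ht, h⟩
      obtain ⟨b, hb⟩ := exists_coe_eq (v := v) ht
      rw [hval t b _ hb, hval t b _ hb, hy, WithTop.coe_le_coe, WithTop.coe_le_coe, not_le] at h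
      exact ⟨b, h⟩
  have key : ∀ x : Fin m → K, HasLabel e B n L k (vmap v x) ↔ (L = ∅ ∧ k = 0) ∨ (L.Nonempty ∧
      ∃ i, i ∉ ⋃₀ L ∧ ¬ x i = 0 ∧ (∀ j, j ∈ ⋃₀ L ∨ v (x i) ≤ v (x j)) ∧
        ∃ t : K, ¬ t = 0 ∧ v (t ^ (n * B) * (π : K) ^ (k * B)) ≤ v (x i) ∧
        ¬ v (t ^ (n * B) * (π : K) ^ ((k + 1) * B)) ≤ v (x i)) := by
    intro x
    refine or_congr Iff.rfl (and_congr_right fun _ => ?_)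
    constructor
    · rintro ⟨g, ⟨⟨i, hi, hig⟩, hmin⟩, hg⟩
      have hig' : v (x i) = g := hig
      refine ⟨i, hi, ?_, fun j => ?_, (hblock _ g hig').1 hg⟩
      · have : v (x i) ≠ ⊤ := by rw [hig']; exact WithTop.coe_ne_top
        exact (AddValuation.ne_top_iff v).1 this
      · by_cases hj : j ∈ ⋃₀ L
        · exact Or.inl hj
        · rw [hig']
          exact Or.inr (hmin ⟨j, hj, rfl⟩)
    · rintro ⟨i, hi, hx, hmin, ht⟩
      obtain ⟨g, hg⟩ := exists_coe_eq (v := v) hx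
      refine ⟨g, ⟨⟨i, hi, hg⟩, ?_⟩, (hblock _ g hg).2 ht⟩
      rintro _ ⟨j, hj, rfl⟩
      rw [← hg]
      exact (hmin j).resolve_left hj
  simp only [key]
  refine .or (fieldDefinable_const _) (.and (fieldDefinable_const _) (.exists fun i =>
    .and (fieldDefinable_const _) (.and (.not ((isPolyFun_apply i).definable_eq
      (isPolyFun_const 0))) (.and (.forall fun j => .or (fieldDefinable_const _)
        ((isPolyFun_apply i).definable_val_le hv hπ (isPolyFun_apply j)))
        (.exists_elem (.and (.not ?_) (.and ?_ (.not ?_))))))))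
  · exact (isPolyFun_apply _).definable_eq (isPolyFun_const 0)
  · exact (((isPolyFun_apply _).pow _).mul (isPolyFun_const _)).definable_val_le hv hπ
      (isPolyFun_apply (Sum.inl i))
  · exact (((isPolyFun_apply _).pow _).mul (isPolyFun_const _)).definable_val_le hv hπ
      (isPolyFun_apply (Sum.inl i))

theorem exists_mem_valClosure_of_biUnion {ι : Type*} {s : Set ι} (hs : s.Finite)
    {f : ι → Set (Fin m → K)} {y : Fin m → K} (hy : y ∈ valClosure v (⋃ i ∈ s, f i)) :
    ∃ i ∈ s, y ∈ valClosure v (f i) := by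
  let _ := valPiTop v m
  have h : y ∈ closure (⋃ i ∈ s, f i) := hy
  rw [hs.closure_biUnion] at h
  obtain ⟨i, hi, h⟩ := mem_iUnion₂.1 h
  exact ⟨i, hi, h⟩

/-- The piece of index `k` of the union of a family `C`. -/
def piece (v : AddValuation K (WithTop G)) (e : G) (B n : ℕ) (C : Set (Set (Fin m → K))) (k : ℕ) :
    Set (Fin m → K) :=
  {x | ∃ S ∈ C, x ∈ S ∧ HasLabel e B n (boundarySupports v (⋃₀ C) S) k (vmap v x)}

variable {π : valRing v} {M : ℕ} {N : Fin m → ℕ} {C : Set (Set (Fin m → K))}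

theorem piece_subset {e : G} {B n k : ℕ} : piece v e B n C k ⊆ ⋃₀ C :=
  fun _ ⟨S, hS, hx, _⟩ => ⟨S, hS, hx⟩

theorem IsMonotopeComplex.exists_mem_piece (hv : IsPAdicallyClosed v)
    (hπ : IsLocalRing.maximalIdeal (valRing v) = Ideal.span {π})
    (hC : IsMonotopeComplex v π M N C) (hopen : IsRelativelyOpen v (⋃₀ C))
    {e : G} (he : IsLeast {x : G | 0 < x} e) {B n : ℕ} (hB : 1 ≤ B) (hn : 1 ≤ n)
    {x : Fin m → K} (hx : x ∈ ⋃₀ C) : ∃ k < n, x ∈ piece v e B n C k := by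
  obtain ⟨S, hS, hxS⟩ := hx
  obtain ⟨k, hk, h⟩ := hv.zGroup.exists_hasLabel he hB hn
    (hC.sUnion_boundarySupports_ssubset hv hπ hopen hS hxS)
  exact ⟨k, hk, S, hS, hxS, h⟩

/-- A piece does not accumulate at the points of the other pieces, hence is closed in the union: the
label of a point of the union is that of every piece which accumulates at this point. -/
theorem IsMonotopeComplex.eq_of_mem_closure_piece (hv : IsPAdicallyClosed v)
    (hπ : IsLocalRing.maximalIdeal (valRing v) = Ideal.span {π})
    (hC : IsMonotopeComplex v π M N C) (hopen : IsRelativelyOpen v (⋃₀ C))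
    {e : G} (he : IsLeast {x : G | 0 < x} e) {B n k k' : ℕ} (hk : k < n) (hk' : k' < n)
    {y : Fin m → K} (hy : y ∈ piece v e B n C k) (hy' : y ∈ valClosure v (piece v e B n C k')) :
    k = k' := by
  obtain ⟨T, hT, hyT, hlabel⟩ := hy
  have hfin : piece v e B n C k' = ⋃ S ∈ C,
      {x ∈ S | HasLabel e B n (boundarySupports v (⋃₀ C) S) k' (vmap v x)} := by
    ext x
    simp only [piece, mem_ofPred_eq, mem_iUnion, exists_prop]
  rw [hfin] at hy'
  obtain ⟨S, hS, hyS⟩ := exists_mem_valClosure_of_biUnion hC.finite hy'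
  have hyS' : y ∈ valClosure v S :=
    @closure_mono _ (valPiTop v m) _ _ (sep_subset _ _) _ hyS
  rw [← (hC.boundarySupports_eq hv hπ hopen hS hT hyT hyS').1] at hlabel
  obtain ⟨c, hc⟩ := hlabel.of_near
  obtain ⟨c', hc'⟩ := exists_vmap_mem_gamNear v y c
  obtain ⟨x, ⟨-, hxl⟩, hx⟩ := (mem_valClosure hv).1 hyS c'
  exact (hc _ (hc' x hx)).eq he hk hk' hxl

/-- Each piece accumulates at every point `y` of the boundary. A point `x` of a monotope near `y` is
moved along a direction `w` towards `y` by multiplying its coordinates by powers of `π`; the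
minimum which defines the label then increases by steps which are smaller than the blocks. -/
theorem IsMonotopeComplex.mem_closure_piece (hv : IsPAdicallyClosed v)
    (hπ : IsLocalRing.maximalIdeal (valRing v) = Ideal.span {π})
    (hC : IsMonotopeComplex v π M N C) (hopen : IsRelativelyOpen v (⋃₀ C))
    {e : G} (he : IsLeast {x : G | 0 < x} e) (hπe : v (π : K) = (e : WithTop G)) {B n : ℕ}
    (hB : 1 ≤ B) (hn : 1 ≤ n) (hdir : ∀ S ∈ C, ∀ y ∈ gamClosure (vmap v '' S), ∃ w,
      IsDirection (vmap v '' S) y w ∧ ∀ i, w i ≤ B) (k : ℕ) {y : Fin m → K}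
    (hy : y ∈ valClosure v (⋃₀ C) \ ⋃₀ C) : y ∈ valClosure v (piece v e B n C k) := by
  have hyC := hy.1
  rw [sUnion_eq_biUnion] at hyC
  obtain ⟨S, hS, hyS'⟩ := exists_mem_valClosure_of_biUnion hC.finite hyC
  have hyL : gamSupp (vmap v y) ∈ boundarySupports v (⋃₀ C) S := ⟨y, ⟨hyS', hy.2⟩, rfl⟩
  obtain ⟨w, hw, hwB⟩ := hdir S hS _ ((hC.mem_valClosure_iff hS).1 hyS').2
  rw [mem_valClosure hv]
  intro c
  obtain ⟨x, hxS, hxc⟩ := (mem_valClosure hv).1 hyS' c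
  let X : ℕ → Fin m → K := fun j i => x i * (π : K) ^ (w i * j)
  have hXv : ∀ j i, vmap v (X j) i = vmap v x i + (((w i * j) • e : G) : WithTop G) := by
    intro j i
    simp only [X, vmap, AddValuation.map_mul, AddValuation.map_pow, hπe]
    rfl
  have hXS : ∀ j, X j ∈ S := by
    intro j
    rw [hC.mem_iff hS]
    constructor
    · have : vmap v (X j) = gamShift w (j • e) (vmap v x) := by
        funext i
        rw [hXv, mul_smul]
        rfl
      rw [this]
      exact hw.shift_mem _ ⟨x, hxS, rfl⟩ _ (nsmul_nonneg he.1.le j)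
    · exact fun i => mul_pow_mem_DR hv hπ (hC.subset_DRm hS hxS i) _
  have hXnear : ∀ j i, (c : WithTop G) < v (X j i - y i) := by
    intro j i
    by_cases hi : y i = 0
    · have h1 := hxc i
      rw [hi, sub_zero] at h1 ⊢
      refine h1.trans_le ?_
      have h2 : v (X j i) = v (x i) + (((w i * j) • e : G) : WithTop G) := hXv j i
      rw [h2]
      exact le_add_of_nonneg_right (by exact_mod_cast nsmul_nonneg he.1.le _)
    · have h1 := hw.eq_zero i ((AddValuation.ne_top_iff v).2 hi)
      simpa [X, h1] using hxc i
  choose h hh using fun j => exists_isLeast_coe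
    (hC.sUnion_boundarySupports_ssubset hv hπ hopen hS (hXS j) ⟨_, hyL⟩)
  have hsucc : ∀ j i, vmap v (X (j + 1)) i = vmap v (X j) i + ((w i • e : G) : WithTop G) := by
    intro j i
    rw [hXv, hXv, mul_add, mul_one, add_smul, WithTop.coe_add, add_assoc]
  have hwpos : ∀ i ∉ ⋃₀ boundarySupports v (⋃₀ C) S, 0 < w i := by
    intro i hi
    refine hw.pos i (by_contra fun hne => hi ⟨_, hyL, hne⟩)
  obtain ⟨j, hj⟩ := hv.zGroup.exists_inBlock_of_step he hB hn (h := h) (fun j => by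
      obtain ⟨i, hi, hih⟩ := (hh (j + 1)).1
      have h1 := (hh j).2 ⟨i, hi, rfl⟩
      have h2 : 1 • e ≤ w i • e := nsmul_le_nsmul_left he.1.le (hwpos i hi)
      rw [one_smul] at h2
      rw [← WithTop.coe_le_coe, ← hih, hsucc, WithTop.coe_add]
      exact add_le_add h1 (WithTop.coe_le_coe.2 h2)) (fun j => by
      obtain ⟨i, hi, hih⟩ := (hh j).1
      have h1 := (hh (j + 1)).2 ⟨i, hi, rfl⟩
      rw [hsucc, hih] at h1
      have h2 : w i • e ≤ B • e := nsmul_le_nsmul_left he.1.le (hwB i)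
      have h3 : h (j + 1) ≤ h j + w i • e := by exact_mod_cast h1
      exact h3.trans (add_le_add_right h2 _)) k
  exact ⟨X j, ⟨S, hS, hXS j, Or.inr ⟨⟨_, hyL⟩, h j, hh j, hj⟩⟩, hXnear j⟩

theorem IsMonotopeComplex.fieldDefinable_piece (hv : IsPAdicallyClosed v)
    (hπ : IsLocalRing.maximalIdeal (valRing v) = Ideal.span {π})
    (hC : IsMonotopeComplex v π M N C) {e : G} (hπe : v (π : K) = (e : WithTop G)) (B n k : ℕ) :
    FieldDefinable (piece v e B n C k) := by
  have := hC.finite.to_subtype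
  have h : piece v e B n C k = {x | ∃ S : C, x ∈ S.1 ∧
      HasLabel e B n (boundarySupports v (⋃₀ C) S.1) k (vmap v x)} := by
    ext x
    simp only [piece, mem_ofPred_eq, Subtype.exists, exists_prop]
  rw [h]
  exact .exists fun S => .and ((hC.monotope S.1 S.2).1.fieldDefinable hv hπ)
    (definable_hasLabel hv hπ hπe _ _ _ _)

end Field

end PadicPolytope

open PadicPolytope in
theorem proposition6p4 {K : Type*} [Field K] {G : Type*} [AddCommGroup G] [LinearOrder G]
    [IsOrderedAddMonoid G] (v : AddValuation K (WithTop G)) (hv : IsPAdicallyClosed v)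
    (π : valRing v) (hπ : IsLocalRing.maximalIdeal (valRing v) = Ideal.span {π})
    (M : ℕ) (hM : 1 ≤ M) (m : ℕ) (N : Fin m → ℕ) (hN : ∀ i, 1 ≤ N i)
    (A : Set (Fin m → K)) (hA : A ⊆ DRm v π M m) (hopen : IsRelativelyOpen v A)
    (hcomplex : ∃ C : Set (Set (Fin m → K)), IsMonotopeComplex v π M N C ∧ ⋃₀ C = A)
    (n : ℕ) (hn : 1 ≤ n) :
    ∃ B : Fin n → Set (Fin m → K),
      (⋃ k, B k) = A ∧ Pairwise (fun k l => Disjoint (B k) (B l)) ∧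
      (∀ k, IsSemialgebraic (B k)) ∧ ∀ k, valFrontier v (B k) = valFrontier v A := by
  obtain ⟨C, hC, rfl⟩ := hcomplex
  obtain ⟨e, he, hπe⟩ := hv.isLeast_uniformizer hπ
  obtain ⟨b, hb, hdir⟩ := hC.exists_bounded_directions hv hN
  have hclosure : ∀ k, piece v e b n C k ⊆ valClosure v (piece v e b n C k) :=
    fun k => @subset_closure _ (valPiTop v m) _
  refine ⟨fun k => piece v e b n C k, ?_, ?_, fun k => hC.fieldDefinable_piece hv hπ hπe b n k,
    fun k => ?_⟩
  · refine Subset.antisymm (iUnion_subset fun k => piece_subset) fun x hx => ?_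
    obtain ⟨k, hk, hxk⟩ := hC.exists_mem_piece hv hπ hopen he hb hn hx
    exact mem_iUnion.2 ⟨⟨k, hk⟩, hxk⟩
  · refine fun k l hkl => disjoint_left.2 fun x hxk hxl => hkl (Fin.ext ?_)
    exact hC.eq_of_mem_closure_piece hv hπ hopen he k.2 l.2 hxk (hclosure l hxl)
  · -- the pieces are closed in the union and accumulate at the same points outside it
    refine congrArg (valClosure v) (Subset.antisymm (fun y hy => ?_) fun y hy => ?_)
    · refine ⟨@closure_mono _ (valPiTop v m) _ _ piece_subset _ hy.1, fun hyA => hy.2 ?_⟩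
      obtain ⟨l, hl, hyl⟩ := hC.exists_mem_piece hv hπ hopen he hb hn hyA
      have := hC.eq_of_mem_closure_piece hv hπ hopen he hl k.2 hyl hy.1
      rwa [this] at hyl
    · exact ⟨hC.mem_closure_piece hv hπ hopen he hπe hb hn hdir k hy, fun h => hy.2 (piece_subset h)⟩
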